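/- Let $(K,\partial)$ be a differential field of characteristic zero whose field of constants $C$ is algebraically closed. In the ring $C\{u\}=C[u,u',u'',\dots]$ of differential polynomials let $\partial^{-1}$ denote the antiderivative without constant term of a total derivative, and put $$\mathrm{kdv}_0=u',\quad \mathrm{kdv}_n=\bigl(-\tfrac14\partial^2+u+\tfrac12u'\partial^{-1}\bigr)(\mathrm{kdv}_{n-1}),\qquad v_0=1,\quad v_n=\bigl(-\tfrac14\partial^2+u-\tfrac12\partial^{-1}u'\bigr)(v_{n-1}),$$ $$P_1=\partial,\quad P_{2n+1}=v_n\partial-\tfrac12\partial(v_n)+P_{2n-1}(-\partial^2+u)\qquad(n\ge1).$$ An element $u_s\in K$ is a KdV potential of level $s$ if $s$ is the smallest integer $n\ge1$ for which there are $c_1,\dots,c_n\in C$ with $\mathrm{kdv}_n(u_s)+\sum_{l=0}^{n-1}c_{n-l}\,\mathrm{kdv}_l(u_s)=0$. Let $u_s\in K$ be a KdV potential of level $s$, let $(c_1,\dots,c_s)\in C^s$ be constants for which this equation holds with $n=s$, and put $$L_s=-\partial^2+u_s,\qquad A_{2s+1}=P_{2s+1}(u_s)+\sum_{l=0}^{s-1}c_{s-l}P_{2l+1}(u_s)\quad\text{in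 } K[\partial].$$ For differential operators $P,Q$ of orders $n,m$ and $0\le i\le k<\min(n,m)$ let $S_k^i(P,Q)$ be the square matrix of size $n+m-2k$ whose rows are the coefficient vectors of $\partial^{m-1-k}P,\dots,\partial P,P,\partial^{n-1-k}Q,\dots,\partial Q,Q$, restricted to the columns of $\partial^{n+m-k-1},\dots,\partial^{k+1},\partial^i$. Put $\mathcal L_k(P,Q)=\sum_{i=0}^k\det(S_k^i(P,Q))\,\partial^i$ (the $k$-th differential subresultant) and $\partial\mathrm{Res}(P,Q)=\det S_0^0(P,Q)$ (the differential resultant). Let $\lambda,\mu$ be algebraic indeterminates over $K$ with $\partial\lambda=\partial\mu=0$, and let $f_s=\partial\mathrm{Res}(L_s-\lambda,A_{2s+1}-\mu)\in K[\lambda,\mu]$, the polynomial that defines the spectral curve $\Gamma_s$. **Theorem.** The polynomial $f_s$ satisfies $\partial f_s=0$ (that is, $f_s\in C[\lambda,\mu]$) and is irreducible in $K[\lambda,\mu]$; hence the fraction field $K(\Gamma_s)$ of the domain $K[\lambda,\mu]/(f_s)$ is a differential field with the induced derivation. Consider $L_s-\lambda$ and $A_{2s+1}-\mu$ as elements of $K(\Gamma_s)[\partial]$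 and let $\mathcal L_1=\varphi_2\partial+\varphi_1$ be their first differential subresultant. Then: 1. $\mathcal L_1$ has order $1$ (so $\varphi_2\neq0$ in $K(\Gamma_s)$), and it is a greatest common right divisor of $L_s-\lambda$ and $A_{2s+1}-\mu$ in $K(\Gamma_s)[\partial]$: it divides both on the right, and every common right divisor of the two divides $\mathcal L_1$ on the right. 2. With $\phi_s=-\varphi_1/\varphi_2\in K(\Gamma_s)$ one has $L_s-\lambda=(-\partial-\phi_s)(\partial-\phi_s)$ in $K(\Gamma_s)[\partial]$. 3. $\partial(\phi_s)+\phi_s^2=u_s-\lambda$ in $K(\Gamma_s)$. -/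

import Mathlib

noncomputable section

namespace KdV

open Polynomial

/-! ### Derivations and rings of differential operators -/

/-- Derivations of a commutative ring. -/
abbrev Der (E : Type*) [CommRing E] : Type _ := Derivation ℤ E E

/-- An additive map that satisfies the Leibniz rule, as a derivation. -/
def derOfAddHom {E : Type*} [CommRing E] (g : E →+ E)
    (hg : ∀ a b, g (a * b) = a * g b + b * g a) : Der E :=
  Derivation.mk' g.toIntLinearMap hg

/-- The field of constants of a differential field `(K, D)`. -/
def constants {K : Type*} [Field K] (D : Der K) : Subfield K where
  carrier := {a | D a = 0}
  mul_mem' := by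
    intro a b ha hb
    simp only [Set.mem_ofPred_eq] at *
    simp [ha, hb]
  one_mem' := by simp
  add_mem' := by
    intro a b ha hb
    simp only [Set.mem_ofPred_eq] at *
    simp [ha, hb]
  zero_mem' := by simp
  neg_mem' := by
    intro a ha
    simp only [Set.mem_ofPred_eq] at *
    simp [ha]
  inv_mem' := by
    intro a ha
    simp only [Set.mem_ofPred_eq] at *
    simp [Derivation.leibniz_inv, ha]

/-- The coefficientwise extension of a derivation `D` of `E` to `E[X]`; thus `X` is a constant. -/
def coeffDeriv {E : Type*} [CommRing E] (D : Der E) : Der E[X] :=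
  letI : Differential E := ⟨D⟩
  Differential.mapCoeffs

lemma coeff_coeffDeriv {E : Type*} [CommRing E] (D : Der E) (p : E[X]) (i : ℕ) :
    (coeffDeriv D p).coeff i = D (p.coeff i) := rfl

lemma coeffDeriv_C {E : Type*} [CommRing E] (D : Der E) (a : E) :
    coeffDeriv D (C a) = C (D a) :=
  letI : Differential E := ⟨D⟩
  Differential.mapCoeffs_C a

/-- The ring `E[∂]` of differential operators with coefficients in `(E, D)`. As an additive group
it is the group of polynomials `∑ aᵢ Xⁱ`, where such a polynomial stands for `∑ aᵢ ∂ⁱ`; the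
multiplication is given below. -/
def DiffOp {E : Type*} [CommRing E] (_D : Der E) : Type _ := E[X]

namespace DiffOp

variable {E : Type*} [CommRing E] {D : Der E}

instance : AddCommGroup (DiffOp D) := inferInstanceAs (AddCommGroup E[X])

/-- The operator `∑ aᵢ ∂ⁱ`, read as the polynomial `∑ aᵢ Xⁱ`. -/
def toPoly (P : DiffOp D) : E[X] := P

/-- The operator `∑ aᵢ ∂ⁱ` with coefficients those of the polynomial `∑ aᵢ Xⁱ`. -/
def ofPoly (D : Der E) (p : E[X]) : DiffOp D := p

/-- The coefficient of `∂ⁱ` (coefficients are written on the left of `∂ⁱ`). -/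
def coeff (P : DiffOp D) (i : ℕ) : E := P.toPoly.coeff i

/-- The order of a differential operator (`0` for the zero operator). -/
def order (P : DiffOp D) : ℕ := P.toPoly.natDegree

variable (D) in
/-- Left multiplication by `∂`: `∂ (∑ aᵢ ∂ⁱ) = ∑ (aᵢ ∂ⁱ⁺¹ + D(aᵢ) ∂ⁱ)`. -/
def shift : Module.End ℤ E[X] :=
  (coeffDeriv D : E[X] →ₗ[ℤ] E[X]) + LinearMap.mulLeft ℤ (X : E[X])

lemma shift_apply (q : E[X]) : shift D q = coeffDeriv D q + X * q := rfl

/-- Left multiplication by the elements of `E`. -/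
def scal : E →+* Module.End ℤ E[X] :=
  (Algebra.lmul ℤ E[X] : E[X] →+* Module.End ℤ E[X]).comp C

lemma scal_apply (a : E) (q : E[X]) : scal a q = C a * q := rfl

variable (D) in
/-- Left multiplication by the operator `∑ aᵢ ∂ⁱ`. -/
def act (p : E[X]) : Module.End ℤ E[X] := p.eval₂ scal (shift D)

lemma act_add (p q : E[X]) : act D (p + q) = act D p + act D q := eval₂_add _ _

lemma act_monomial (n : ℕ) (a : E) : act D (monomial n a) = scal a * shift D ^ n :=
  eval₂_monomial _ _

/-- The commutation rule `∂ a = a ∂ + D(a)`. -/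
lemma shift_mul_scal (a : E) : shift D * scal a = scal a * shift D + scal (D a) := by
  ext1 q
  simp only [Module.End.mul_apply, LinearMap.add_apply, shift_apply, scal_apply,
    Derivation.leibniz, coeffDeriv_C, smul_eq_mul]
  ring

lemma act_shift (p : E[X]) : act D (shift D p) = shift D * act D p := by
  induction p using Polynomial.induction_on' with
  | add p q hp hq => rw [map_add, act_add, hp, hq, act_add, mul_add]
  | monomial n a =>
    have h : shift D (monomial n a) = monomial n (D a) + monomial (n + 1) a := by
      rw [shift_apply, X_mul_monomial]
      congr 1
      let _ : Differential E := ⟨D⟩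
      exact Differential.mapCoeffs_monomial n a
    rw [h, act_add, act_monomial, act_monomial, act_monomial, ← mul_assoc, shift_mul_scal,
      add_mul, pow_succ', mul_assoc, add_comm]

lemma act_scal (a : E) (p : E[X]) : act D (scal a p) = scal a * act D p := by
  induction p using Polynomial.induction_on' with
  | add p q hp hq => rw [map_add, act_add, hp, hq, act_add, mul_add]
  | monomial n b =>
    rw [scal_apply, C_mul_monomial, act_monomial, act_monomial, map_mul, mul_assoc]

lemma act_act (p q : E[X]) : act D (act D p q) = act D p * act D q := by
  induction p using Polynomial.induction_on' with
  | add p r hp hr => rw [act_add, LinearMap.add_apply, act_add, hp, hr, add_mul]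
  | monomial n a =>
    have h : ∀ r : E[X], act D ((shift D ^ n) r) = shift D ^ n * act D r := by
      induction n with
      | zero => intro r; simp
      | succ n ih =>
        intro r
        rw [pow_succ', Module.End.mul_apply, act_shift, ih, mul_assoc]
    rw [act_monomial, Module.End.mul_apply, act_scal, h, mul_assoc]

lemma act_one : act D (1 : E[X]) = 1 := by
  rw [act, eval₂_one]

lemma act_apply_one (p : E[X]) : act D p 1 = p := by
  induction p using Polynomial.induction_on' with
  | add p r hp hr => rw [act_add, LinearMap.add_apply, hp, hr]
  | monomial n a =>
    have h : (shift D ^ n) (1 : E[X]) = X ^ n := by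
      induction n with
      | zero => simp
      | succ n ih =>
        rw [pow_succ', Module.End.mul_apply, ih, shift_apply, Derivation.leibniz_pow,
          ← pow_succ']
        have : coeffDeriv D (X : E[X]) = 0 := by
          let _ : Differential E := ⟨D⟩
          exact Differential.mapCoeffs_X
        simp [this]
    rw [act_monomial, Module.End.mul_apply, h, scal_apply, C_mul_X_pow_eq_monomial]

instance : Ring (DiffOp D) where
  __ := (inferInstance : AddCommGroup (DiffOp D))
  one := ofPoly D 1
  mul P Q := ofPoly D (act D P.toPoly Q.toPoly)
  left_distrib P Q R := map_add (act D P.toPoly) Q.toPoly R.toPoly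
  right_distrib P Q R := by
    change act D (P.toPoly + Q.toPoly) R.toPoly = _
    rw [act_add]
    rfl
  zero_mul P := by
    change act D 0 P.toPoly = 0
    rw [act, eval₂_zero]
    rfl
  mul_zero P := map_zero (act D P.toPoly)
  mul_assoc P Q R := by
    change act D (act D P.toPoly Q.toPoly) R.toPoly = act D P.toPoly (act D Q.toPoly R.toPoly)
    rw [act_act]
    rfl
  one_mul P := by
    change act D 1 P.toPoly = P.toPoly
    rw [act_one]
    rfl
  mul_one P := act_apply_one P.toPoly
  zsmul := (inferInstance : AddCommGroup (DiffOp D)).zsmul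
  zsmul_zero' := (inferInstance : AddCommGroup (DiffOp D)).zsmul_zero'
  zsmul_succ' := (inferInstance : AddCommGroup (DiffOp D)).zsmul_succ'
  zsmul_neg' := (inferInstance : AddCommGroup (DiffOp D)).zsmul_neg'
  neg_add_cancel := (inferInstance : AddCommGroup (DiffOp D)).neg_add_cancel

variable (D) in
/-- The operator `∂`. -/
def partial_ : DiffOp D := ofPoly D X

variable (D) in
/-- The operator of multiplication by `a ∈ E`, that is, `a` as an operator of order zero. -/
def coe (a : E) : DiffOp D := ofPoly D (C a)

/-- The defining relation `∂ a = a ∂ + D(a)` of `E[∂]`. -/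
lemma partial_mul_coe (a : E) :
    partial_ D * coe D a = coe D a * partial_ D + coe D (D a) := by
  have h₁ : partial_ D * coe D a = act D X (C a) := rfl
  have h₂ : coe D a * partial_ D = act D (C a) X := rfl
  have h₃ : coe D (D a) = (C (D a) : E[X]) := rfl
  rw [h₁, h₂, h₃, act, act, eval₂_X, eval₂_C, shift_apply, scal_apply, coeffDeriv_C,
    add_comm, mul_comm]
  rfl

/-- Every operator is `∑ aᵢ ∂ⁱ`, its coefficients being the `aᵢ`. -/
lemma eq_sum_coeff (P : DiffOp D) :
    P = ∑ i ∈ Finset.range (P.order + 1), coe D (P.coeff i) * partial_ D ^ i := by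
  have hpow : ∀ i : ℕ, partial_ D ^ i = ofPoly D (X ^ i) := by
    intro i
    induction i with
    | zero => rw [pow_zero, pow_zero]; rfl
    | succ i ih =>
      rw [pow_succ, ih]
      change act D (X ^ i) X = (X ^ (i + 1) : E[X])
      have h := act_act (D := D) (X ^ i) X
      rw [← act_apply_one (D := D) (act D (X ^ i) X), h]
      rw [act, act, eval₂_X_pow, eval₂_X, ← pow_succ, ← eval₂_X_pow (f := scal), ← act,
        act_apply_one]
  have hterm : ∀ i : ℕ, coe D (P.coeff i) * partial_ D ^ i =
      ofPoly D (C (P.coeff i) * X ^ i) := by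
    intro i
    rw [hpow]
    change act D (C (P.coeff i)) (X ^ i) = _
    rw [act, eval₂_C]
    rfl
  simp only [hterm]
  exact P.toPoly.as_sum_range_C_mul_X_pow

/-- Application of a map `φ : E → E'` of coefficient rings to the coefficients of an operator
(a ring homomorphism `E[∂] → E'[∂]` when `φ` commutes with the derivations). -/
def map {E' : Type*} [CommRing E'] (D' : Der E') (φ : E →+* E') (P : DiffOp D) :
    DiffOp D' :=
  ofPoly D' (P.toPoly.map φ)

/-- `G` is a right divisor of `P` in `E[∂]`. -/
def RightDvd (G P : DiffOp D) : Prop := ∃ B : DiffOp D, P = B * G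

/-- `G` is a greatest common right divisor of `P` and `Q` in `E[∂]`. -/
def IsGCRD (G P Q : DiffOp D) : Prop :=
  RightDvd G P ∧ RightDvd G Q ∧ ∀ H : DiffOp D, RightDvd H P → RightDvd H Q → RightDvd H G

/-! ### Differential resultant and subresultants -/

/-- The square matrix `S_k^i(P, Q)` for operators `P`, `Q` of orders `n`, `m` and
`0 ≤ i ≤ k < min n m`. Its rows are the coefficient vectors of
`∂^(m-1-k) P, …, ∂ P, P, ∂^(n-1-k) Q, …, ∂ Q, Q`; its columns are indexed by the powers
`∂^(n+m-k-1), …, ∂^(k+1), ∂^i`. -/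
def subresMatrix (P Q : DiffOp D) (n m k i : ℕ) :
    Matrix (Fin ((m - k) + (n - k))) (Fin ((m - k) + (n - k))) E :=
  Matrix.of fun r c =>
    DiffOp.coeff
      (Fin.append (fun a : Fin (m - k) => partial_ D ^ (m - 1 - k - (a : ℕ)) * P)
        (fun b : Fin (n - k) => partial_ D ^ (n - 1 - k - (b : ℕ)) * Q) r)
      (if (c : ℕ) + 1 = (m - k) + (n - k) then i else n + m - k - 1 - (c : ℕ))

/-- The `k`-th differential subresultant `𝓛_k = ∑_{i ≤ k} det (S_k^i) ∂ⁱ` of `P` and `Q`. -/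
def subres (k : ℕ) (P Q : DiffOp D) : DiffOp D :=
  ∑ i ∈ Finset.range (k + 1), coe D (subresMatrix P Q P.order Q.order k i).det * partial_ D ^ i

/-- The differential resultant `∂Res(P, Q) = det (S_0(P, Q))`. -/
def dRes (P Q : DiffOp D) : E := (subresMatrix P Q P.order Q.order 0 0).det

end DiffOp

open DiffOp

/-! ### The KdV hierarchy over the ring `F{u}` of differential polynomials -/

section Hierarchy

variable (F : Type*) [Field F]

/-- The ring `F{u} = F[u, u', u'', …]`; the variable `X n` is `u⁽ⁿ⁾`. -/
abbrev DiffPoly : Type _ := MvPolynomial ℕ F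

/-- The derivation of `F{u}`: it is `F`-linear and maps `u⁽ⁿ⁾` to `u⁽ⁿ⁺¹⁾`. -/
def formalDeriv : Der (DiffPoly F) :=
  (MvPolynomial.mkDerivation F (fun n : ℕ => (MvPolynomial.X (n + 1) : DiffPoly F))).restrictScalars ℤ

open Classical in
/-- `∂⁻¹` on total derivatives: the antiderivative without constant term. -/
def antideriv (p : DiffPoly F) : DiffPoly F :=
  if h : ∃ q : DiffPoly F, formalDeriv F q = p ∧ MvPolynomial.constantCoeff q = 0 then h.choose
  else 0

/-- `𝓡 = -¼ ∂² + u + ½ u' ∂⁻¹`. -/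
def recOp (p : DiffPoly F) : DiffPoly F :=
  -MvPolynomial.C (1 / 4) * formalDeriv F (formalDeriv F p) + MvPolynomial.X 0 * p
    + MvPolynomial.C (1 / 2) * MvPolynomial.X 1 * antideriv F p

/-- `𝓡* = -¼ ∂² + u - ½ ∂⁻¹ u'`. -/
def recOpAdj (p : DiffPoly F) : DiffPoly F :=
  -MvPolynomial.C (1 / 4) * formalDeriv F (formalDeriv F p) + MvPolynomial.X 0 * p
    - MvPolynomial.C (1 / 2) * antideriv F (MvPolynomial.X 1 * p)

/-- `kdv_0 = u'`, `kdv_n = 𝓡(kdv_{n-1})`. -/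
def kdv : ℕ → DiffPoly F
  | 0 => MvPolynomial.X 1
  | n + 1 => recOp F (kdv n)

/-- `v_0 = 1`, `v_n = 𝓡*(v_{n-1})`. -/
def v : ℕ → DiffPoly F
  | 0 => 1
  | n + 1 => recOpAdj F (v n)

/-- The formal Schrödinger operator `L(u) = -∂² + u`. -/
def formalL : DiffOp (formalDeriv F) :=
  -partial_ (formalDeriv F) ^ 2 + coe (formalDeriv F) (MvPolynomial.X 0)

/-- `formalP n` is `P_{2n+1}`: `P_1 = ∂`, `P_{2n+1} = v_n ∂ - ½ ∂(v_n) + P_{2n-1} L`. -/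
def formalP : ℕ → DiffOp (formalDeriv F)
  | 0 => partial_ (formalDeriv F)
  | n + 1 =>
    coe (formalDeriv F) (v F (n + 1)) * partial_ (formalDeriv F)
      - coe (formalDeriv F) (MvPolynomial.C (1 / 2) * formalDeriv F (v F (n + 1)))
      + formalP n * formalL F

variable {F}

/-- `KdV_n(u, c) = kdv_n + ∑_{l<n} c_{n-l} kdv_l`; the constant `c_j` is `c ⟨j - 1, _⟩`. -/
def bigKdV (n : ℕ) (c : Fin n → F) : DiffPoly F :=
  kdv F n + ∑ l : Fin n, MvPolynomial.C (c l.rev) * kdv F l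

/-- `P̂_{2n+1}(u, c) = P_{2n+1} + ∑_{l<n} c_{n-l} P_{2l+1}`; the constant `c_j` is
`c ⟨j - 1, _⟩`. -/
def hatP (n : ℕ) (c : Fin n → F) : DiffOp (formalDeriv F) :=
  formalP F n + ∑ l : Fin n, coe (formalDeriv F) (MvPolynomial.C (c l.rev)) * formalP F l

end Hierarchy

/-! ### Potentials, the operators `L` and `A_{2s+1}`, the spectral curve -/

section Curve

variable {K : Type*} [Field K] (D : Der K) (u : K)

/-- The substitution of a potential in `K` for the differential indeterminate, `C{u} → K`. -/
def subst : DiffPoly (constants D) →+* K :=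
  (MvPolynomial.aeval (fun n : ℕ => D^[n] u) : DiffPoly (constants D) →ₐ[constants D] K)

/-- The set of `ξ ∈ Cⁿ` with `KdV_n(u, ξ) = 0`. -/
def kdvConstants (n : ℕ) : Set (Fin n → constants D) :=
  {ξ | subst D u (bigKdV n ξ) = 0}

/-- `u` is a KdV potential of KdV level `s`: the integer `s` is the smallest `n ≥ 1` such that
`KdV_n(u, ξ) = 0` for some `ξ ∈ Cⁿ`. -/
def IsKdVLevel (s : ℕ) : Prop :=
  IsLeast {n : ℕ | 1 ≤ n ∧ (kdvConstants D u n).Nonempty} s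

/-- The Schrödinger operator `L = -∂² + u` in `K[∂]`. -/
def schrodinger : DiffOp D := -partial_ D ^ 2 + coe D u

/-- The operator `A_{2s+1} = P̂_{2s+1}(u, c)` in `K[∂]`. -/
def opA {s : ℕ} (c : Fin s → constants D) : DiffOp D := (hatP s c).map D (subst D u)

/-- The derivation of `K[λ, μ]` that extends that of `K` with `∂λ = ∂μ = 0`. Here `K[λ, μ]` is
`K[X][X]`, with `λ = C X` and `μ = X`. -/
abbrev biDeriv : Der K[X][X] := coeffDeriv (coeffDeriv D)

/-- `L - λ` in `K[λ, μ][∂]`. -/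
def opLLambda : DiffOp (biDeriv D) :=
  (schrodinger D u).map (biDeriv D) (C.comp C) - coe (biDeriv D) (C X)

/-- `A_{2s+1} - μ` in `K[λ, μ][∂]`. -/
def opAMu {s : ℕ} (c : Fin s → constants D) : DiffOp (biDeriv D) :=
  (opA D u c).map (biDeriv D) (C.comp C) - coe (biDeriv D) X

/-- The polynomial `f_s(λ, μ) = ∂Res(L - λ, A_{2s+1} - μ)` that defines the spectral curve. -/
def spectralPoly {s : ℕ} (c : Fin s → constants D) : K[X][X] :=
  dRes (opLLambda D u) (opAMu D u c)

end Curve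

section FunctionField

variable {K : Type*} [Field K]

/-- The coordinate ring `K[λ, μ]/(f)`. -/
abbrev CoordRing (f : K[X][X]) : Type _ := AdjoinRoot f

/-- `K(Γ)`, the fraction field of `K[λ, μ]/(f)` for an irreducible `f`. -/
abbrev FunField (f : K[X][X]) : Type _ := FractionRing (CoordRing f)

lemma coordRing_isDomain {f : K[X][X]} (hf : Irreducible f) : IsDomain (CoordRing f) :=
  AdjoinRoot.isDomain_of_prime hf.prime

/-- The class in `K(Γ)` of a polynomial in `λ` and `μ`. -/
def toFunField (f : K[X][X]) : K[X][X] →+* FunField f :=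
  (algebraMap (CoordRing f) (FunField f)).comp (AdjoinRoot.mk f)

lemma coordDeriv_aux (D : Der K) (f : K[X][X]) (hf : biDeriv D f = 0) (p : K[X][X])
    (hp : (AdjoinRoot.mk f).toIntAlgHom p = 0) :
    (AdjoinRoot.mk f).toIntAlgHom (biDeriv D p) = 0 := by
  obtain ⟨q, rfl⟩ := AdjoinRoot.mk_eq_zero.1 hp
  change AdjoinRoot.mk f (biDeriv D (f * q)) = 0
  rw [Derivation.leibniz, hf, smul_zero, add_zero, smul_eq_mul, map_mul, AdjoinRoot.mk_self,
    zero_mul]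

/-- The derivation of `K[λ, μ]/(f)` induced by that of `K[λ, μ]`, when `∂f = 0`. -/
def coordDeriv (D : Der K) (f : K[X][X]) (hf : biDeriv D f = 0) : Der (CoordRing f) :=
  Derivation.liftOfSurjective (f := (AdjoinRoot.mk f).toIntAlgHom) AdjoinRoot.mk_surjective
    (d := biDeriv D) (coordDeriv_aux D f hf)

lemma coordDeriv_mk (D : Der K) (f : K[X][X]) (hf : biDeriv D f = 0) (p : K[X][X]) :
    coordDeriv D f hf (AdjoinRoot.mk f p) = AdjoinRoot.mk f (biDeriv D p) :=
  Derivation.liftOfSurjective_apply (f := (AdjoinRoot.mk f).toIntAlgHom) AdjoinRoot.mk_surjective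
    (d := biDeriv D) (coordDeriv_aux D f hf) p

/-- For a derivation `d` of `A`, the ring homomorphism `a ↦ a + ε d(a)` from `A` to the dual
numbers over the total ring of fractions of `A`. -/
def jet {A : Type*} [CommRing A] (d : Der A) : A →+* DualNumber (FractionRing A) where
  toFun a := TrivSqZeroExt.inl (algebraMap A (FractionRing A) a) +
    TrivSqZeroExt.inr (algebraMap A (FractionRing A) (d a))
  map_one' := by simp
  map_zero' := by simp
  map_add' a b := by
    ext
    · simp
    · simp only [map_add, TrivSqZeroExt.snd_add, TrivSqZeroExt.snd_inl, TrivSqZeroExt.snd_inr]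
      ring
  map_mul' a b := by
    ext
    · simp
    · simp only [DualNumber.snd_mul, map_add, map_mul, Derivation.leibniz, smul_eq_mul,
        TrivSqZeroExt.snd_add, TrivSqZeroExt.fst_add, TrivSqZeroExt.snd_inl,
        TrivSqZeroExt.snd_inr, TrivSqZeroExt.fst_inl, TrivSqZeroExt.fst_inr]
      ring

/-- The extension of `jet d` to the total ring of fractions. -/
def jetFrac {A : Type*} [CommRing A] (d : Der A) :
    FractionRing A →+* DualNumber (FractionRing A) :=
  IsLocalization.lift (M := nonZeroDivisors A) (g := jet d) (by
    intro y
    rw [TrivSqZeroExt.isUnit_iff_isUnit_fst]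
    simpa [jet] using IsLocalization.map_units (FractionRing A) y)

lemma jetFrac_algebraMap {A : Type*} [CommRing A] (d : Der A) (a : A) :
    jetFrac d (algebraMap A (FractionRing A) a) = jet d a :=
  IsLocalization.lift_eq _ a

lemma fst_jetFrac {A : Type*} [CommRing A] (d : Der A) (z : FractionRing A) :
    (jetFrac d z).fst = z := by
  have h : (TrivSqZeroExt.fstHom (FractionRing A) (FractionRing A) (FractionRing A) :
      DualNumber (FractionRing A) →+* FractionRing A).comp (jetFrac d) = RingHom.id _ := by
    apply IsLocalization.ringHom_ext (nonZeroDivisors A)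
    refine RingHom.ext fun a => ?_
    change (jetFrac d (algebraMap A (FractionRing A) a)).fst = algebraMap A (FractionRing A) a
    rw [jetFrac_algebraMap]
    simp [jet]
  exact congrArg (fun g : FractionRing A →+* FractionRing A => g z) h

/-- The extension of a derivation of `A` to the total ring of fractions of `A`. -/
def fracDeriv {A : Type*} [CommRing A] (d : Der A) : Der (FractionRing A) :=
  derOfAddHom (AddMonoidHom.mk' (fun z => (jetFrac d z).snd) (by
      intro a b
      rw [map_add, TrivSqZeroExt.snd_add])) (by
    intro a b
    change (jetFrac d (a * b)).snd = a * (jetFrac d b).snd + b * (jetFrac d a).snd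
    rw [map_mul, DualNumber.snd_mul, fst_jetFrac, fst_jetFrac]
    ring)

lemma fracDeriv_algebraMap {A : Type*} [CommRing A] (d : Der A) (a : A) :
    fracDeriv d (algebraMap A (FractionRing A) a) = algebraMap A (FractionRing A) (d a) := by
  change (jetFrac d (algebraMap A (FractionRing A) a)).snd = _
  rw [jetFrac_algebraMap]
  change (TrivSqZeroExt.inl _ + TrivSqZeroExt.inr _ : DualNumber (FractionRing A)).snd = _
  rw [TrivSqZeroExt.snd_add, TrivSqZeroExt.snd_inl, TrivSqZeroExt.snd_inr, zero_add]

/-- The derivation of `K(Γ)` induced by that of `K[λ, μ]`, when `∂f = 0`. -/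
def funDeriv (D : Der K) (f : K[X][X]) (hf : biDeriv D f = 0) : Der (FunField f) :=
  fracDeriv (coordDeriv D f hf)

/-- `funDeriv` extends the derivation of `K[λ, μ]`. -/
lemma funDeriv_toFunField (D : Der K) (f : K[X][X]) (hf : biDeriv D f = 0) (p : K[X][X]) :
    funDeriv D f hf (toFunField f p) = toFunField f (biDeriv D p) := by
  rw [funDeriv, toFunField, RingHom.comp_apply, RingHom.comp_apply, fracDeriv_algebraMap,
    coordDeriv_mk]

end FunctionField

end KdV

end

/-! The whole theorem is read off from the right division of `A_{2s+1} - μ` by `L_s - λ`. Put `W = u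
- λ`. As the divisor has leading coefficient `-1`, the division is possible over `K[λ, μ]`, with a
remainder `a ∂ - b`. The recursion for `P_{2n+1}` is a Horner scheme in `L`, so `a` is the
combination of the sums `∑ v_k λ^(n-k)` with coefficients `1, c_1, …, c_s`, and `b = a'/2 + μ`
(`exists_opAMu_eq`, `coeffDeriv_remA`).

Eliminating the rows of `L - λ` in the subresultant matrices (`det_subresMatrix`) shows that `𝓛_1`
is this remainder and that the resultant is `(a' - b) b + a (a W - b') = R(λ) - μ²`, where `R` is
`curvePoly`. As `a` is monic of degree `s` in `λ`, `R` has odd degree `2s + 1`; it is not a square,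
and `f_s` is irreducible.

Constancy: `2 R' = a (-a''' + 4 W a' + 2 u' a)`. By the recursion for the `v_n`, the bracket
telescopes to a multiple of `KdV_s(u, c)`, which vanishes. That recursion needs `u' v_n` to be a
total derivative, and this comes from the same first integral applied to a generating polynomial of
the `v_k`.

On the curve the resultant is zero while `a ≠ 0`. Dividing by `a²` gives the Riccati equation for `φ
= b/a`, hence the factorization of `L - λ`. The remainder thus divides `L - λ`, and the division
with remainder makes it a greatest common right divisor (`subres_one_isGCRD`). -/

noncomputable section

namespace KdV

open Polynomial

/-! ### Antiderivatives of differential polynomials and the recursion for `v_n` -/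

section Hierarchy

variable (F : Type*) [Field F]

lemma formalDeriv_X (n : ℕ) :
    formalDeriv F (MvPolynomial.X n) = MvPolynomial.X (n + 1) :=
  MvPolynomial.mkDerivation_X _ _ _

lemma formalDeriv_C (a : F) : formalDeriv F (MvPolynomial.C a) = 0 :=
  (MvPolynomial.mkDerivation F _).map_algebraMap a

lemma constantCoeff_formalDeriv (p : DiffPoly F) :
    MvPolynomial.constantCoeff (formalDeriv F p) = 0 := by
  induction p using MvPolynomial.induction_on with
  | C a => simp [formalDeriv_C]
  | add p q hp hq => simp [hp, hq]
  | mul_X p n hp => simp [formalDeriv_X, hp]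

/-- The commutator of `∂/∂u⁽ⁿ⁺¹⁾` with the total derivative. It drives the descent on variables in
`eq_C_of_formalDeriv_eq_zero`. -/
lemma pderiv_succ_formalDeriv (p : DiffPoly F) (n : ℕ) :
    MvPolynomial.pderiv (n + 1) (formalDeriv F p) =
      formalDeriv F (MvPolynomial.pderiv (n + 1) p) + MvPolynomial.pderiv n p := by
  induction p using MvPolynomial.induction_on with
  | C a => simp [formalDeriv_C]
  | add p q hp hq => simp only [map_add, hp, hq]; ring
  | mul_X p k hp =>
    have h1 : formalDeriv F (MvPolynomial.pderiv (n + 1) (MvPolynomial.X k)) = 0 := by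
      rw [MvPolynomial.pderiv_X, Pi.single_apply]
      split <;> simp
    have h2 : (MvPolynomial.pderiv (n + 1) (MvPolynomial.X (k + 1)) : DiffPoly F) =
        MvPolynomial.pderiv n (MvPolynomial.X k) := by
      simp [MvPolynomial.pderiv_X, Pi.single_apply]
    simp only [Derivation.leibniz, map_add, hp, formalDeriv_X, smul_eq_mul, h1, h2]
    ring

/-- If `∂p = 0`, the commutator formula carries the vanishing of a partial derivative from index `n
+ 1` to `n`. Only finitely many variables occur, so the descent can start, and all partial
derivatives vanish. This makes antiderivatives without constant term unique. -/
lemma eq_C_of_formalDeriv_eq_zero [CharZero F] {p : DiffPoly F} (hp : formalDeriv F p = 0) :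
    p = MvPolynomial.C (MvPolynomial.constantCoeff p) := by
  have hstep : ∀ n, MvPolynomial.pderiv (n + 1) p = 0 → MvPolynomial.pderiv n p = 0 := by
    intro n hn
    have h := pderiv_succ_formalDeriv F p n
    rwa [hp, hn, map_zero, map_zero, zero_add, eq_comm] at h
  have hall : ∀ n, MvPolynomial.pderiv n p = 0 := by
    obtain ⟨N, hN⟩ : ∃ N, ∀ i ∈ p.vars, i < N :=
      ⟨p.vars.sup id + 1, fun i hi => Nat.lt_succ_of_le (Finset.le_sup (f := id) hi)⟩
    have hbig : ∀ n, N ≤ n → MvPolynomial.pderiv n p = 0 := fun n hn =>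
      MvPolynomial.pderiv_eq_zero_of_notMem_vars fun h => absurd (hN n h) (by omega)
    intro n
    rcases le_total N n with h | h
    · exact hbig n h
    · exact Nat.decreasingInduction (motive := fun k _ => MvPolynomial.pderiv k p = 0)
        (fun k _ hk => hstep k hk) (hbig N le_rfl) h
  ext m
  rw [MvPolynomial.coeff_C]
  split_ifs with hm
  · rw [← hm]; rfl
  · obtain ⟨i, hi⟩ : ∃ i, m i ≠ 0 := by
      by_contra! h
      exact hm (Finsupp.ext fun i => (h i).symm)
    have h := congrArg (MvPolynomial.coeff (m - Finsupp.single i 1)) (hall i)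
    rw [MvPolynomial.coeff_pderiv, tsub_add_cancel_of_le
      (Finsupp.single_le_iff.2 (Nat.one_le_iff_ne_zero.2 hi)), MvPolynomial.coeff_zero] at h
    exact (mul_eq_zero.1 h).resolve_right (Nat.cast_add_one_ne_zero _)

lemma formalDeriv_antideriv {p : DiffPoly F} (h : ∃ q, formalDeriv F q = p) :
    formalDeriv F (antideriv F p) = p := by
  have h' : ∃ q : DiffPoly F, formalDeriv F q = p ∧ MvPolynomial.constantCoeff q = 0 := by
    obtain ⟨q, hq⟩ := h
    exact ⟨q - MvPolynomial.C (MvPolynomial.constantCoeff q), by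
      rw [map_sub, formalDeriv_C, sub_zero, hq], by simp⟩
  rw [antideriv, dif_pos h']
  exact h'.choose_spec.1

lemma constantCoeff_antideriv (p : DiffPoly F) :
    MvPolynomial.constantCoeff (antideriv F p) = 0 := by
  rw [antideriv]
  split_ifs with h
  · exact h.choose_spec.2
  · simp

lemma antideriv_formalDeriv [CharZero F] {q : DiffPoly F}
    (hq : MvPolynomial.constantCoeff q = 0) : antideriv F (formalDeriv F q) = q := by
  have h := eq_C_of_formalDeriv_eq_zero F (p := antideriv F (formalDeriv F q) - q) (by
    rw [map_sub, formalDeriv_antideriv F ⟨q, rfl⟩, sub_self])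
  rw [map_sub, constantCoeff_antideriv, hq, sub_zero, map_zero, sub_eq_zero] at h
  exact h

variable {F} in
/-- The first integral of the equation `4 V' = t (-V''' + 2 u' V + 4 u V')`. -/
lemma deriv_first_integral {R : Type*} [CommRing R] (d : Der R) (V U t : R) (ht : d t = 0) :
    d (4 * V ^ 2 + t * (2 * V * d (d V) - d V ^ 2 - 4 * U * V ^ 2)) =
      2 * V * (4 * d V + t * (d (d (d V)) - 2 * d U * V - 4 * U * d V)) := by
  have h2 : d 2 = 0 := by simpa using d.map_natCast 2
  have h4 : d 4 = 0 := by simpa using d.map_natCast 4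
  simp only [map_add, map_sub, Derivation.leibniz, Derivation.leibniz_pow, smul_eq_mul, ht, h2,
    h4]
  ring

/-- If the recursion `4 w_{j+1}' = -w_j''' + 4 u w_j' + 2 u' w_j` holds for `j < n`, then its
right-hand side for `j = n` is twice a total derivative. -/
lemma exists_formalDeriv_eq_of_recursion (w : ℕ → DiffPoly F) (h0 : w 0 = 1) (n : ℕ)
    (h : ∀ j < n, 4 * formalDeriv F (w (j + 1)) =
      -formalDeriv F (formalDeriv F (formalDeriv F (w j)))
        + 4 * MvPolynomial.X 0 * formalDeriv F (w j) + 2 * MvPolynomial.X 1 * w j) :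
    ∃ q, formalDeriv F q =
      2 * (-formalDeriv F (formalDeriv F (formalDeriv F (w n)))
        + 4 * MvPolynomial.X 0 * formalDeriv F (w n) + 2 * MvPolynomial.X 1 * w n) := by
  set d := formalDeriv F
  -- The truncated generating polynomial `V = ∑ w_k tᵏ`, `t = X`. The factor `G` in
  -- `deriv_first_integral` encodes the recursion: its coefficients up to `tⁿ` vanish, and that of
  -- `tⁿ⁺¹` is the wanted expression up to sign, since `V` stops at `tⁿ`.
  let V : (DiffPoly F)[X] := ∑ k ∈ Finset.range (n + 1), monomial k (w k)
  have hV : ∀ j, V.coeff j = if j ≤ n then w j else 0 := by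
    intro j
    simp only [V, finsetSum_coeff, coeff_monomial, Finset.sum_ite_eq', Finset.mem_range,
      Nat.lt_succ_iff]
  have hfi := congrArg (fun p => coeff p (n + 1)) (deriv_first_integral (coeffDeriv d) V
    (C (MvPolynomial.X 0)) X (by
      let _ : Differential (DiffPoly F) := ⟨d⟩
      exact Differential.mapCoeffs_X))
  set G : (DiffPoly F)[X] := 4 * coeffDeriv d V + X * (coeffDeriv d (coeffDeriv d (coeffDeriv d V))
    - 2 * coeffDeriv d (C (MvPolynomial.X 0)) * V - 4 * C (MvPolynomial.X 0) * coeffDeriv d V)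
    with hGdef
  have h2C : (2 : (DiffPoly F)[X]) = C 2 := rfl
  have h4C : (4 : (DiffPoly F)[X]) = C 4 := rfl
  have hd1 : d 1 = 0 := d.map_one_eq_zero
  have hGs : ∀ j, G.coeff (j + 1) = 4 * d (V.coeff (j + 1)) + (d (d (d (V.coeff j)))
      - 2 * MvPolynomial.X 1 * V.coeff j - 4 * MvPolynomial.X 0 * d (V.coeff j)) := by
    intro j
    rw [hGdef, coeffDeriv_C, formalDeriv_X, h2C, h4C]
    simp only [← C_mul, coeff_add, coeff_C_mul, coeff_X_mul, coeff_sub, coeff_coeffDeriv]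
  have hGz : ∀ j ≤ n, G.coeff j = 0 := by
    intro j hj
    cases j with
    | zero =>
      rw [hGdef, h4C, coeff_add, coeff_X_mul_zero, coeff_C_mul, coeff_coeffDeriv, hV]
      simp [h0, hd1]
    | succ j =>
      rw [hGs, hV, hV, if_pos hj, if_pos (by omega), h j (by omega)]
      ring
  -- Only the constant term `w 0 = 1` of `V` meets a coefficient of `G` not known to vanish.
  have hprod : (2 * V * G).coeff (n + 1) = 2 * G.coeff (n + 1) := by
    rw [mul_assoc, h2C, coeff_C_mul, coeff_mul, Finset.Nat.sum_antidiagonal_succ]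
    rw [hV 0, if_pos (Nat.zero_le _), h0, one_mul, Finset.sum_eq_zero, add_zero]
    intro x hx
    rw [hGz x.2 (by have := Finset.HasAntidiagonal.mem_antidiagonal.1 hx; omega), mul_zero]
  refine ⟨-(coeff (4 * V ^ 2 + X * (2 * V * coeffDeriv d (coeffDeriv d V) - coeffDeriv d V ^ 2
    - 4 * C (MvPolynomial.X 0) * V ^ 2)) (n + 1)), ?_⟩
  rw [map_neg, ← coeff_coeffDeriv]
  refine (congrArg Neg.neg (hfi.trans hprod)).trans ?_
  rw [hGs, hV, hV, if_neg (by omega), if_pos le_rfl, map_zero]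
  ring

lemma formalDeriv_C_mul (a : F) (p : DiffPoly F) :
    formalDeriv F (MvPolynomial.C a * p) = MvPolynomial.C a * formalDeriv F p := by
  rw [Derivation.leibniz, formalDeriv_C, smul_zero, add_zero, smul_eq_mul]

lemma constantCoeff_v_succ (n : ℕ) : MvPolynomial.constantCoeff (v F (n + 1)) = 0 := by
  simp [v, recOpAdj, constantCoeff_formalDeriv, constantCoeff_antideriv]

variable [CharZero F]

lemma C_mul_four (p : DiffPoly F) : 4 * (MvPolynomial.C (1 / 4) * p) = p := by
  rw [← mul_assoc, show (4 : DiffPoly F) = MvPolynomial.C 4 from rfl, ← MvPolynomial.C_mul]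
  norm_num

lemma C_mul_two (p : DiffPoly F) : 2 * (MvPolynomial.C (1 / 2) * p) = p := by
  rw [← mul_assoc, show (2 : DiffPoly F) = MvPolynomial.C 2 from rfl, ← MvPolynomial.C_mul]
  norm_num

/-- The recursion for the derivatives of the `v_n`. -/
lemma four_mul_formalDeriv_v_succ (n : ℕ) : 4 * formalDeriv F (v F (n + 1)) =
    -formalDeriv F (formalDeriv F (formalDeriv F (v F n)))
      + 4 * MvPolynomial.X 0 * formalDeriv F (v F n) + 2 * MvPolynomial.X 1 * v F n := by
  induction n using Nat.strong_induction_on with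
  | _ n ih =>
  obtain ⟨q, hq⟩ := exists_formalDeriv_eq_of_recursion F (v F) rfl n ih
  have hex : ∃ r, formalDeriv F r = MvPolynomial.X 1 * v F n := by
    -- Solve `q' = 2 (-v''' + 4 u v' + 2 u' v)` for `u' v`, using `u v' = (u v)' - u' v`.
    refine ⟨MvPolynomial.C (1 / 4) * (-q - 2 * formalDeriv F (formalDeriv F (v F n))
      + 8 * (MvPolynomial.X 0 * v F n)), ?_⟩
    have h2 : formalDeriv F 2 = 0 := by simpa using (formalDeriv F).map_natCast 2
    have h8 : formalDeriv F 8 = 0 := by simpa using (formalDeriv F).map_natCast 8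
    have h' : formalDeriv F (-q - 2 * formalDeriv F (formalDeriv F (v F n))
        + 8 * (MvPolynomial.X 0 * v F n)) = 4 * (MvPolynomial.X 1 * v F n) := by
      simp only [map_add, map_sub, map_neg, Derivation.leibniz, smul_eq_mul, hq, h2, h8,
        formalDeriv_X]
      ring
    rw [formalDeriv_C_mul, h', mul_left_comm, C_mul_four]
  have h : formalDeriv F (v F (n + 1)) =
      -(MvPolynomial.C (1 / 4) * formalDeriv F (formalDeriv F (formalDeriv F (v F n))))
      + (MvPolynomial.X 0 * formalDeriv F (v F n) + MvPolynomial.X 1 * v F n)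
      - MvPolynomial.C (1 / 2) * (MvPolynomial.X 1 * v F n) := by
    rw [v, recOpAdj, neg_mul, map_sub, map_add, map_neg, formalDeriv_C_mul, formalDeriv_C_mul,
      formalDeriv_antideriv F hex, Derivation.leibniz, formalDeriv_X, smul_eq_mul, smul_eq_mul]
    ring
  rw [h]
  linear_combination -C_mul_four F (formalDeriv F (formalDeriv F (formalDeriv F (v F n))))
    - 2 * C_mul_two F (MvPolynomial.X 1 * v F n)

/-- The operators `𝓡` and `𝓡*` are intertwined by `∂`. This turns the KdV equation into one on the
derivatives of the `v_n`. -/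
lemma kdv_eq (n : ℕ) : kdv F n = 2 * formalDeriv F (v F (n + 1)) := by
  induction n with
  | zero =>
    have h := four_mul_formalDeriv_v_succ F 0
    simp only [show v F 0 = 1 from rfl, Derivation.map_one_eq_zero, map_zero] at h
    rw [kdv]
    have h2 : (2 : DiffPoly F) ≠ 0 := two_ne_zero
    refine mul_left_cancel₀ h2 ?_
    linear_combination -h
  | succ n ih =>
    -- No constant of integration appears, because `v_{n+1}` has no constant term.
    have ha : antideriv F (kdv F n) = 2 * v F (n + 1) := by
      rw [← antideriv_formalDeriv F (q := 2 * v F (n + 1)) (by simp [constantCoeff_v_succ]), ih]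
      rw [Derivation.leibniz, show formalDeriv F 2 = 0 by simpa using (formalDeriv F).map_natCast 2,
        smul_zero, add_zero, smul_eq_mul]
    rw [kdv, recOp, ha, ih]
    have h := four_mul_formalDeriv_v_succ F (n + 1)
    have h2 : formalDeriv F 2 = 0 := by simpa using (formalDeriv F).map_natCast 2
    simp only [Derivation.leibniz, smul_eq_mul, h2, mul_zero, add_zero]
    have h4 : (4 : DiffPoly F) ≠ 0 := OfNat.ofNat_ne_zero 4
    refine mul_left_cancel₀ h4 ?_
    linear_combination -2 * h
      - 2 * C_mul_four F (formalDeriv F (formalDeriv F (formalDeriv F (v F (n + 1)))))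
      + 4 * C_mul_two F (MvPolynomial.X 1 * v F (n + 1))

end Hierarchy

/-! ### Coefficients of differential operators -/

namespace DiffOp

variable {E : Type*} [CommRing E] {D : Der E}

@[ext] lemma ext_coeff {P Q : DiffOp D} (h : ∀ i, P.coeff i = Q.coeff i) : P = Q :=
  Polynomial.ext h

@[simp] lemma coeff_add (P Q : DiffOp D) (i : ℕ) : (P + Q).coeff i = P.coeff i + Q.coeff i :=
  Polynomial.coeff_add P.toPoly Q.toPoly i

@[simp] lemma coeff_sub (P Q : DiffOp D) (i : ℕ) : (P - Q).coeff i = P.coeff i - Q.coeff i :=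
  Polynomial.coeff_sub P.toPoly Q.toPoly i

@[simp] lemma coeff_neg (P : DiffOp D) (i : ℕ) : (-P).coeff i = -P.coeff i :=
  Polynomial.coeff_neg P.toPoly i

@[simp] lemma coeff_zero (i : ℕ) : (0 : DiffOp D).coeff i = 0 := Polynomial.coeff_zero i

lemma coeff_one (i : ℕ) : (1 : DiffOp D).coeff i = if i = 0 then 1 else 0 := by
  change (1 : E[X]).coeff i = _
  rw [Polynomial.coeff_one]

variable (D) in
/-- Taking the coefficient of `∂ⁱ`, as an additive map. -/
def coeffHom (i : ℕ) : DiffOp D →+ E where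
  toFun P := P.coeff i
  map_zero' := coeff_zero i
  map_add' P Q := coeff_add P Q i

lemma coeff_sum {ι : Type*} (s : Finset ι) (f : ι → DiffOp D) (i : ℕ) :
    (∑ j ∈ s, f j).coeff i = ∑ j ∈ s, (f j).coeff i :=
  map_sum (coeffHom D i) f s

@[simp] lemma coeff_coe_mul (a : E) (P : DiffOp D) (i : ℕ) :
    (coe D a * P).coeff i = a * P.coeff i := by
  change (act D (C a) P.toPoly).coeff i = _
  rw [act, eval₂_C, scal_apply, Polynomial.coeff_C_mul]
  rfl

lemma partial_mul_toPoly (P : DiffOp D) :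
    (partial_ D * P).toPoly = coeffDeriv D P.toPoly + X * P.toPoly := by
  change act D X P.toPoly = _
  rw [act, eval₂_X, shift_apply]

@[simp] lemma coeff_partial_mul_succ (P : DiffOp D) (i : ℕ) :
    (partial_ D * P).coeff (i + 1) = D (P.coeff (i + 1)) + P.coeff i := by
  rw [coeff, partial_mul_toPoly, Polynomial.coeff_add, coeff_coeffDeriv, coeff_X_mul]
  rfl

@[simp] lemma coeff_partial_mul_zero (P : DiffOp D) :
    (partial_ D * P).coeff 0 = D (P.coeff 0) := by
  rw [coeff, partial_mul_toPoly, Polynomial.coeff_add, coeff_coeffDeriv, coeff_X_mul_zero,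
    add_zero]
  rfl

lemma coeff_coe (a : E) (i : ℕ) : (coe D a).coeff i = if i = 0 then a else 0 :=
  Polynomial.coeff_C

lemma coeff_partial (i : ℕ) : (partial_ D).coeff i = if 1 = i then 1 else 0 :=
  Polynomial.coeff_X

variable (D) in
/-- The inclusion of `E` in `E[∂]`. -/
def coeHom : E →+* DiffOp D where
  toFun := coe D
  map_one' := by ext i; rw [coeff_coe, coeff_one]
  map_zero' := by ext i; rw [coeff_coe, coeff_zero, ite_self]
  map_add' a b := by
    ext i
    rw [coeff_add, coeff_coe, coeff_coe, coeff_coe]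
    split <;> simp
  map_mul' a b := by
    ext i
    rw [coeff_coe_mul, coeff_coe, coeff_coe, mul_ite, mul_zero]

lemma coe_add (a b : E) : coe D (a + b) = coe D a + coe D b := map_add (coeHom D) a b
lemma coe_sub (a b : E) : coe D (a - b) = coe D a - coe D b := map_sub (coeHom D) a b
lemma coe_neg (a : E) : coe D (-a) = -coe D a := map_neg (coeHom D) a
lemma coe_mul (a b : E) : coe D (a * b) = coe D a * coe D b := map_mul (coeHom D) a b
lemma coe_one : coe D 1 = 1 := map_one (coeHom D)
lemma coe_zero : coe D 0 = 0 := map_zero (coeHom D)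
lemma coe_sum {ι : Type*} (s : Finset ι) (f : ι → E) :
    coe D (∑ j ∈ s, f j) = ∑ j ∈ s, coe D (f j) := map_sum (coeHom D) f s

/-! ### Orders -/

lemma coeff_eq_zero_of_order_lt {P : DiffOp D} {i : ℕ} (h : P.order < i) : P.coeff i = 0 :=
  Polynomial.coeff_eq_zero_of_natDegree_lt h

lemma order_eq {P : DiffOp D} {n : ℕ} (h : ∀ i, n < i → P.coeff i = 0) (hn : P.coeff n ≠ 0) :
    P.order = n :=
  le_antisymm (natDegree_le_iff_coeff_eq_zero.2 fun i hi => h i hi) (le_natDegree_of_ne_zero hn)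

lemma eq_sum_coeff_of_bound {B : DiffOp D} {N : ℕ} (h : ∀ i, N ≤ i → B.coeff i = 0) :
    B = ∑ j ∈ Finset.range N, coe D (B.coeff j) * partial_ D ^ j := by
  conv_lhs => rw [eq_sum_coeff B]
  have hz : ∀ M, ∀ j, M ≤ j → (∀ i, M ≤ i → B.coeff i = 0) →
      coe D (B.coeff j) * partial_ D ^ j = 0 := by
    intro M j hj hM
    rw [hM j hj, coe_zero, zero_mul]
  rcases le_total N (B.order + 1) with h' | h'
  · symm
    refine Finset.sum_subset (Finset.range_mono h') fun j _ hj => hz N j (by simpa using hj) h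
  · refine Finset.sum_subset (Finset.range_mono h') fun j _ hj => hz (B.order + 1) j
      (by simpa using hj) fun i hi => coeff_eq_zero_of_order_lt hi

lemma coeff_mul_eq_sum {B : DiffOp D} {N : ℕ} (h : ∀ i, N ≤ i → B.coeff i = 0) (P : DiffOp D)
    (i : ℕ) :
    (B * P).coeff i = ∑ j ∈ Finset.range N, B.coeff j * (partial_ D ^ j * P).coeff i := by
  conv_lhs => rw [eq_sum_coeff_of_bound h]
  rw [Finset.sum_mul, coeff_sum]
  refine Finset.sum_congr rfl fun j _ => ?_
  rw [mul_assoc, coeff_coe_mul]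

lemma coeff_partial_pow_mul {P : DiffOp D} {n : ℕ} (h : ∀ i, n < i → P.coeff i = 0) (j : ℕ) :
    (∀ i, j + n < i → (partial_ D ^ j * P).coeff i = 0) ∧
      (partial_ D ^ j * P).coeff (j + n) = P.coeff n := by
  induction j with
  | zero => simpa using h
  | succ j ih =>
    rw [pow_succ', mul_assoc]
    refine ⟨fun i hi => ?_, ?_⟩
    · obtain ⟨i, rfl⟩ : ∃ k, i = k + 1 := ⟨i - 1, by omega⟩
      rw [coeff_partial_mul_succ, ih.1 _ (by omega), ih.1 _ (by omega), map_zero, add_zero]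
    · rw [show j + 1 + n = j + n + 1 by omega, coeff_partial_mul_succ, ih.1 _ (by omega), ih.2,
        map_zero, zero_add]

lemma coeff_mul_of_bound {P Q : DiffOp D} {n m : ℕ} (hP : ∀ i, n < i → P.coeff i = 0)
    (hQ : ∀ i, m < i → Q.coeff i = 0) :
    (∀ i, n + m < i → (P * Q).coeff i = 0) ∧
      (P * Q).coeff (n + m) = P.coeff n * Q.coeff m := by
  have hP' : ∀ i, n + 1 ≤ i → P.coeff i = 0 := fun i hi => hP i hi
  refine ⟨fun i hi => ?_, ?_⟩
  · rw [coeff_mul_eq_sum hP']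
    refine Finset.sum_eq_zero fun j hj => ?_
    rw [(coeff_partial_pow_mul hQ j).1 i (by simp at hj; omega), mul_zero]
  · rw [coeff_mul_eq_sum hP', Finset.sum_range_succ, (coeff_partial_pow_mul hQ n).2,
      Finset.sum_eq_zero, zero_add]
    intro j hj
    rw [(coeff_partial_pow_mul hQ j).1 _ (by simp at hj; omega), mul_zero]

/-! ### Change of coefficients -/

section Map

variable {E' : Type*} [CommRing E'] {D' : Der E'} {φ : E →+* E'}

lemma coeff_map (P : DiffOp D) (i : ℕ) : (P.map D' φ).coeff i = φ (P.coeff i) :=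
  Polynomial.coeff_map φ i

lemma map_coe (a : E) : (coe D a).map D' φ = coe D' (φ a) := Polynomial.map_C φ

lemma map_partial : (partial_ D).map D' φ = partial_ D' := Polynomial.map_X φ

lemma map_partial_pow_mul (hφ : ∀ a, φ (D a) = D' (φ a)) (P : DiffOp D) (j : ℕ) :
    (partial_ D ^ j * P).map D' φ = partial_ D' ^ j * P.map D' φ := by
  induction j with
  | zero => simp
  | succ j ih =>
    rw [pow_succ', pow_succ', mul_assoc, mul_assoc, ← ih]
    ext i
    cases i <;> simp [coeff_map, hφ]

variable (D D' φ) in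
/-- `DiffOp.map` as a ring homomorphism. -/
def mapHom (hφ : ∀ a, φ (D a) = D' (φ a)) : DiffOp D →+* DiffOp D' where
  toFun P := P.map D' φ
  map_one' := Polynomial.map_one φ
  map_zero' := Polynomial.map_zero φ
  map_add' P Q := Polynomial.map_add φ
  map_mul' P Q := by
    have h : ∀ i, P.order + 1 ≤ i → P.coeff i = 0 := fun i hi => coeff_eq_zero_of_order_lt hi
    have h' : ∀ i, P.order + 1 ≤ i → (P.map D' φ).coeff i = 0 := fun i hi => by
      rw [coeff_map, h i hi, map_zero]
    ext i
    rw [coeff_mul_eq_sum h', coeff_map, coeff_mul_eq_sum h, map_sum]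
    refine Finset.sum_congr rfl fun j _ => ?_
    rw [map_mul, ← map_partial_pow_mul hφ, coeff_map, coeff_map]

lemma mapHom_apply (hφ : ∀ a, φ (D a) = D' (φ a)) (P : DiffOp D) :
    mapHom D D' φ hφ P = P.map D' φ := rfl

end Map

/-! ### Subresultants from division with remainder -/

section Resultant

variable {E : Type*} [CommRing E] {D : Der E}

/-- Elimination of `P` from the rows of `Q` in the matrix `S_k^i(P, Q)`. -/
lemma det_subresMatrix {P Q : DiffOp D} {n m k : ℕ} (i : ℕ) (hn : k < n) (hm : k < m)
    (hP : ∀ j, n < j → P.coeff j = 0) (R B : Fin (n - k) → DiffOp D)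
    (hR : ∀ b j, n ≤ j → (R b).coeff j = 0) (hB : ∀ b j, m - k ≤ j → (B b).coeff j = 0)
    (hQ : ∀ b : Fin (n - k), partial_ D ^ (n - 1 - k - (b : ℕ)) * Q = R b + B b * P) :
    (subresMatrix P Q n m k i).det = P.coeff n ^ (m - k) *
      (Matrix.of fun b c : Fin (n - k) =>
        (R b).coeff (if (c : ℕ) + 1 = n - k then i else n - 1 - c)).det := by
  let col : Fin ((m - k) + (n - k)) → ℕ := fun c =>
    if (c : ℕ) + 1 = (m - k) + (n - k) then i else n + m - k - 1 - (c : ℕ)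
  let U : Matrix (Fin (m - k)) (Fin (m - k)) E := Matrix.of fun a c =>
    (partial_ D ^ (m - 1 - k - (a : ℕ)) * P).coeff (col (Fin.castAdd _ c))
  let V : Matrix (Fin (m - k)) (Fin (n - k)) E := Matrix.of fun a c =>
    (partial_ D ^ (m - 1 - k - (a : ℕ)) * P).coeff (col (Fin.natAdd _ c))
  let β : Matrix (Fin (n - k)) (Fin (m - k)) E := Matrix.of fun b a =>
    (B b).coeff (m - k - 1 - (a : ℕ))
  let Z : Matrix (Fin (n - k)) (Fin (n - k)) E := Matrix.of fun b c : Fin (n - k) =>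
    (R b).coeff (if (c : ℕ) + 1 = n - k then i else n - 1 - c)
  -- The exceptional last column `∂ⁱ` lies in the second block, since `k < n`; the first block
  -- therefore has the powers `n + m - 1 - k, …, n`, where the `R b` vanish.
  have hcol₁ : ∀ c : Fin (m - k), col (Fin.castAdd _ c) = n + (m - 1 - k - (c : ℕ)) := by
    intro c
    have := c.2
    simp only [col, Fin.val_castAdd]
    rw [if_neg (by omega)]
    omega
  have hcol₂ : ∀ c : Fin (n - k), col (Fin.natAdd (m - k) c) =
      if (c : ℕ) + 1 = n - k then i else n - 1 - c := by
    intro c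
    have := c.2
    simp only [col, Fin.val_natAdd]
    split_ifs <;> omega
  have hrow : ∀ (b : Fin (n - k)) (x : ℕ), ∑ a : Fin (m - k), β b a *
      (partial_ D ^ (m - 1 - k - (a : ℕ)) * P).coeff x = (B b * P).coeff x := by
    intro b x
    rw [coeff_mul_eq_sum (hB b), ← Finset.sum_range_reflect, ← Fin.sum_univ_eq_sum_range
      (fun j => (B b).coeff (m - k - 1 - j) * (partial_ D ^ (m - k - 1 - j) * P).coeff x)]
    refine Finset.sum_congr rfl fun a _ => ?_
    rw [show m - 1 - k - (a : ℕ) = m - k - 1 - a by omega]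
    rfl
  -- Subtracting the multiples `B b * P`, which are combinations of the rows of `P`, leaves the rows
  -- of `R b`. The block `U` is upper triangular with the leading coefficient of `P` on its
  -- diagonal.
  have hfac : (subresMatrix P Q n m k i).submatrix finSumFinEquiv finSumFinEquiv =
      Matrix.fromBlocks 1 0 β 1 * Matrix.fromBlocks U V 0 Z := by
    simp only [Matrix.fromBlocks_multiply, Matrix.one_mul, Matrix.zero_mul, Matrix.mul_zero,
      add_zero]
    ext (a | b) (c | c)
    · simp [subresMatrix, U, col]
    · simp [subresMatrix, V, col]
    · have h := hrow b (col (Fin.castAdd _ c))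
      have h' : (R b).coeff (col (Fin.castAdd _ c)) = 0 := hR b _ (by rw [hcol₁]; omega)
      simp only [Matrix.submatrix_apply, finSumFinEquiv_apply_left, finSumFinEquiv_apply_right,
        subresMatrix, Matrix.of_apply, Fin.append_right, hQ, Matrix.fromBlocks_apply₂₁,
        Matrix.mul_apply, U]
      rw [h, coeff_add]
      exact (congrArg (· + _) h').trans (zero_add _)
    · have h := hrow b (col (Fin.natAdd _ c))
      simp only [Matrix.submatrix_apply, finSumFinEquiv_apply_right,
        subresMatrix, Matrix.of_apply, Fin.append_right, hQ, Matrix.fromBlocks_apply₂₂,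
        Matrix.mul_apply, Matrix.add_apply, V, Z]
      rw [h, coeff_add, ← hcol₂, add_comm]
  have hU : U.det = P.coeff n ^ (m - k) := by
    rw [Matrix.det_of_isUpperTriangular]
    · rw [Finset.prod_congr rfl (g := fun _ => P.coeff n), Finset.prod_const, Finset.card_univ,
        Fintype.card_fin]
      intro a _
      simp only [U, Matrix.of_apply, hcol₁]
      rw [add_comm n, (coeff_partial_pow_mul hP _).2]
    · intro a c hac
      have hac' : (c : ℕ) < a := hac
      have := a.2
      simp only [U, Matrix.of_apply, hcol₁]
      exact (coeff_partial_pow_mul hP _).1 _ (by omega)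
  rw [← Matrix.det_submatrix_equiv_self finSumFinEquiv, hfac, Matrix.det_mul,
    Matrix.det_fromBlocks_zero₁₂, Matrix.det_fromBlocks_zero₂₁, hU]
  simp [Z]

variable {L A B : DiffOp D} {W a b : E} {s : ℕ}

lemma coeff_neg_partial_sq_add_coe (hL : L = -partial_ D ^ 2 + coe D W) :
    (∀ j, 2 < j → L.coeff j = 0) ∧ L.coeff 2 = -1 := by
  have h := coeff_partial_pow_mul (D := D) (P := 1) (n := 0)
    (fun i hi => by rw [coeff_one, if_neg hi.ne']) 2
  rw [mul_one, add_zero] at h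
  subst hL
  refine ⟨fun j hj => ?_, ?_⟩
  · rw [coeff_add, coeff_neg, coeff_coe, h.1 j hj, if_neg (by omega), neg_zero, add_zero]
  · rw [coeff_add, coeff_neg, coeff_coe, h.2, coeff_one]
    simp

lemma coeff_coe_mul_partial_sub_coe (j : ℕ) :
    (coe D a * partial_ D - coe D b).coeff j =
      (if j = 1 then a else 0) - if j = 0 then b else 0 := by
  rw [coeff_sub, coeff_coe_mul, coeff_partial, coeff_coe, mul_ite, mul_one, mul_zero]
  simp only [eq_comm]

/-- The resultant of `L = -∂² + W` and `A`, if the remainder of `A` modulo `L` is `a ∂ - b`. -/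
lemma dRes_of_remainder (hL : L = -partial_ D ^ 2 + coe D W) (hB : ∀ j, 2 * s ≤ j → B.coeff j = 0)
    (hA : A = coe D a * partial_ D - coe D b + B * L) (hLo : L.order = 2)
    (hAo : A.order = 2 * s + 1) :
    dRes L A = (D a - b) * b + a * (a * W - D b) := by
  obtain ⟨hL₁, hL₂⟩ := coeff_neg_partial_sq_add_coe hL
  -- The rows are `∂ A` and `A`. Substituting `∂² = W - L` in `∂ (a ∂ - b)` gives the remainder `(a'
  -- - b) ∂ - (b' - a W)` of `∂ A`, with quotient `∂ B - a`.
  rw [dRes, hLo, hAo, det_subresMatrix 0 (by omega) (by omega) hL₁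
    ![coe D (D a - b) * partial_ D - coe D (D b - a * W), coe D a * partial_ D - coe D b]
    ![partial_ D * B - coe D a, B], hL₂]
  · change _ * (Matrix.of fun b' c : Fin 2 => _ : Matrix (Fin 2) (Fin 2) E).det = _
    rw [Matrix.det_fin_two]
    simp only [Matrix.of_apply, Matrix.cons_val_zero, Matrix.cons_val_one,
      coeff_coe_mul_partial_sub_coe]
    have h : (-1 : E) ^ (2 * s + 1 - 0) = -1 := by
      rw [Nat.sub_zero, pow_succ, pow_mul]; simp
    rw [h]
    simp
    ring
  · intro b' j hj
    fin_cases b' <;>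
    · simp only [Fin.zero_eta, Fin.mk_one, Matrix.cons_val_zero, Matrix.cons_val_one]
      rw [coeff_coe_mul_partial_sub_coe, if_neg (by omega), if_neg (by omega), sub_zero]
  · intro b' j hj
    fin_cases b'
    · obtain ⟨j, rfl⟩ : ∃ t, j = t + 1 := ⟨j - 1, by omega⟩
      change (partial_ D * B - coe D a).coeff (j + 1) = 0
      rw [coeff_sub, coeff_partial_mul_succ, coeff_coe, hB _ (by omega), hB _ (by omega)]
      simp
    · exact hB j (by omega)
  · intro b'
    fin_cases b'
    · change partial_ D ^ 1 * A = coe D (D a - b) * partial_ D - coe D (D b - a * W) +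
        (partial_ D * B - coe D a) * L
      have h1 : coe D a * L = -(coe D a * partial_ D * partial_ D) + coe D (a * W) := by
        rw [hL, coe_mul]; noncomm_ring
      have h2 : (partial_ D * B - coe D a) * L = partial_ D * (B * L) - coe D a * L := by
        noncomm_ring
      rw [h2, h1, hA, pow_one, mul_add, mul_sub, partial_mul_coe, ← mul_assoc, partial_mul_coe,
        coe_sub, coe_sub]
      noncomm_ring
    · change partial_ D ^ 0 * A = _
      rw [pow_zero, one_mul]
      exact hA

/-- The first subresultant of `L = -∂² + W` and `A` is the remainder of `A` modulo `L`. -/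
lemma subres_one_of_remainder (hs : 1 ≤ s) (hL : L = -partial_ D ^ 2 + coe D W)
    (hB : ∀ j, 2 * s ≤ j → B.coeff j = 0)
    (hA : A = coe D a * partial_ D - coe D b + B * L) (hLo : L.order = 2)
    (hAo : A.order = 2 * s + 1) :
    subres 1 L A = coe D a * partial_ D - coe D b := by
  obtain ⟨hL₁, hL₂⟩ := coeff_neg_partial_sq_add_coe hL
  have h : ∀ i, (subresMatrix L A 2 (2 * s + 1) 1 i).det =
      (coe D a * partial_ D - coe D b).coeff i := by
    intro i
    -- For `k = 1` only the row `A` remains, and the prefactor is `(-1)^(2s) = 1`, so no sign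
    -- appears.
    rw [det_subresMatrix i (by omega) (by omega) hL₁ (fun _ => coe D a * partial_ D - coe D b)
      (fun _ => B), hL₂]
    · change _ * (Matrix.of fun b' c : Fin 1 => _ : Matrix (Fin 1) (Fin 1) E).det = _
      rw [Matrix.det_fin_one]
      simp
    · intro _ j hj
      rw [coeff_coe_mul_partial_sub_coe, if_neg (by omega), if_neg (by omega), sub_zero]
    · intro _ j hj
      exact hB j (by omega)
    · intro b'
      rw [show 2 - 1 - 1 - (b' : ℕ) = 0 by omega, pow_zero, one_mul]
      exact hA
  rw [subres, hLo, hAo, Finset.sum_range_succ, Finset.sum_range_one, h, h, pow_zero, pow_one,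
    mul_one, coeff_coe_mul_partial_sub_coe, coeff_coe_mul_partial_sub_coe]
  simp [coe_neg, sub_eq_neg_add]

/-- If `φ` satisfies the Riccati equation, then `-∂² + W` factors. -/
lemma factorization_of_riccati {φ : E} (h : D φ + φ ^ 2 = W) :
    -partial_ D ^ 2 + coe D W =
      (-partial_ D - coe D φ) * (partial_ D - coe D φ) := by
  rw [← h, coe_add, pow_two φ, coe_mul, sub_mul, neg_mul, mul_sub, partial_mul_coe]
  noncomm_ring

end Resultant

end DiffOp

open DiffOp

namespace DiffOp

variable {E : Type*} [CommRing E] {D : Der E}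

/-- A constant commutes with `∂`, hence with all operators. Consequently `P L = P (L - x) + x P` for
constant `x`, which lets `L` be replaced by `x` modulo `L - x`. -/
lemma mul_coe_of_const {x : E} (hx : D x = 0) (P : DiffOp D) : P * coe D x = coe D x * P := by
  have h : Commute (partial_ D) (coe D x) := by
    rw [Commute, SemiconjBy, partial_mul_coe, hx, coe_zero, add_zero]
  have h' : Commute P (coe D x) := by
    rw [eq_sum_coeff P]
    refine Commute.sum_left _ _ _ fun i _ => Commute.mul_left ?_ (h.pow_left i)
    rw [Commute, SemiconjBy, ← coe_mul, ← coe_mul, mul_comm]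
  exact h'

end DiffOp

/-! ### Division of `P̂_{2n+1}` by `L - λ` -/

section Division

/-- The sum `∑_{k ≤ n} w_k xⁿ⁻ᵏ`. -/
def horner {E : Type*} [CommRing E] (w : ℕ → E) (x : E) : ℕ → E
  | 0 => w 0
  | n + 1 => w (n + 1) + x * horner w x n

/-- The combination of the sums `horner w x l`, `l ≤ n`, with the coefficients of `P̂_{2n+1}`. -/
def hornerComb {E : Type*} [CommRing E] (w : ℕ → E) (x : E) {n : ℕ} (c : Fin n → E) : E :=
  horner w x n + ∑ l : Fin n, c l.rev * horner w x l

lemma map_horner {E E' : Type*} [CommRing E] [CommRing E'] (g : E →+* E') (w : ℕ → E) (x : E)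
    (n : ℕ) : g (horner w x n) = horner (fun k => g (w k)) (g x) n := by
  induction n with
  | zero => rfl
  | succ n ih => rw [horner, horner, map_add, map_mul, ih]

lemma map_hornerComb {E E' : Type*} [CommRing E] [CommRing E'] (g : E →+* E') (w : ℕ → E) (x : E)
    {n : ℕ} (c : Fin n → E) :
    g (hornerComb w x c) = hornerComb (fun k => g (w k)) (g x) (fun j => g (c j)) := by
  simp only [hornerComb, map_add, map_sum, map_mul, map_horner]

variable {F : Type*} [Field F]

/-- The functions `½ ∂(v_n)`. -/
def halfDerivV (n : ℕ) : DiffPoly F := MvPolynomial.C (1 / 2) * formalDeriv F (v F n)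

lemma formalL_coeff : (∀ i, 2 < i → (formalL F).coeff i = 0) ∧ (formalL F).coeff 2 = -1 :=
  coeff_neg_partial_sq_add_coe rfl

lemma formalP_coeff (n : ℕ) : (∀ i, 2 * n + 1 < i → (formalP F n).coeff i = 0) ∧
    (formalP F n).coeff (2 * n + 1) = (-1) ^ n := by
  induction n with
  | zero =>
    refine ⟨fun i hi => ?_, ?_⟩
    · rw [formalP, coeff_partial, if_neg (by omega)]
    · simp [formalP, coeff_partial]
  | succ n ih =>
    have h := coeff_mul_of_bound ih.1 (formalL_coeff (F := F)).1
    refine ⟨fun i hi => ?_, ?_⟩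
    · rw [formalP, DiffOp.coeff_add, coeff_coe_mul_partial_sub_coe, h.1 i (by omega),
        if_neg (by omega), if_neg (by omega)]
      simp
    · rw [formalP, DiffOp.coeff_add, coeff_coe_mul_partial_sub_coe,
        show 2 * (n + 1) + 1 = 2 * n + 1 + 2 by ring, h.2, ih.2, formalL_coeff.2,
        if_neg (by omega), if_neg (by omega)]
      ring

lemma hatP_coeff {n : ℕ} (c : Fin n → F) :
    (∀ i, 2 * n + 1 < i → (hatP n c).coeff i = 0) ∧
      (hatP n c).coeff (2 * n + 1) = (-1) ^ n := by
  have h : ∀ i, 2 * n + 1 ≤ i → (∑ l : Fin n, coe (formalDeriv F) (MvPolynomial.C (c l.rev)) *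
      formalP F l).coeff i = 0 := by
    intro i hi
    rw [DiffOp.coeff_sum]
    refine Finset.sum_eq_zero fun l _ => ?_
    rw [coeff_coe_mul, (formalP_coeff l).1 i (by have := l.2; omega), mul_zero]
  refine ⟨fun i hi => ?_, ?_⟩
  · rw [hatP, DiffOp.coeff_add, h i (by omega), (formalP_coeff n).1 i hi, add_zero]
  · rw [hatP, DiffOp.coeff_add, h _ le_rfl, (formalP_coeff n).2, add_zero]

variable {E : Type*} [CommRing E] {D : Der E} (ψ : DiffPoly F →+* E)
  (hψ : ∀ a, ψ (formalDeriv F a) = D (ψ a)) {x : E}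

/-- Modulo left multiples of `L - x`, the product `P_{2n+1} L` becomes `x P_{2n+1}`; the defining
recursion thus turns into Horner's scheme for the remainders. -/
lemma exists_formalP_eq (hx : D x = 0) (n : ℕ) : ∃ B : DiffOp D,
    (∀ i, 2 * n ≤ i → B.coeff i = 0) ∧ mapHom _ D ψ hψ (formalP F n) =
      coe D (horner (fun k => ψ (v F k)) x n) * partial_ D
        - coe D (horner (fun k => ψ (halfDerivV k)) x n)
        + B * (mapHom _ D ψ hψ (formalL F) - coe D x) := by
  induction n with
  | zero =>
    refine ⟨0, fun i _ => DiffOp.coeff_zero i, ?_⟩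
    rw [mapHom_apply, formalP, map_partial]
    simp only [horner, v, halfDerivV, Derivation.map_one_eq_zero, mul_zero, map_zero, map_one,
      DiffOp.coe_one, DiffOp.coe_zero]
    simp
  | succ n ih =>
    obtain ⟨B, hB, h⟩ := ih
    -- The new quotient is `P_{2n+1} + x B`, of order at most `2n + 1`.
    refine ⟨mapHom _ D ψ hψ (formalP F n) + coe D x * B, fun i hi => ?_, ?_⟩
    · rw [DiffOp.coeff_add, coeff_coe_mul, hB i (by omega), mapHom_apply, DiffOp.coeff_map,
        (formalP_coeff n).1 i (by omega)]
      simp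
    · have hP : mapHom _ D ψ hψ (formalP F (n + 1)) =
          coe D (ψ (v F (n + 1))) * partial_ D - coe D (ψ (halfDerivV (n + 1)))
            + mapHom _ D ψ hψ (formalP F n) * mapHom _ D ψ hψ (formalL F) := by
        rw [formalP, map_add, map_sub, map_mul, map_mul]
        simp only [mapHom_apply, map_coe, map_partial, halfDerivV]
      have hL : mapHom _ D ψ hψ (formalP F n) * mapHom _ D ψ hψ (formalL F) =
          mapHom _ D ψ hψ (formalP F n) * (mapHom _ D ψ hψ (formalL F) - coe D x)
            + coe D x * mapHom _ D ψ hψ (formalP F n) := by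
        rw [mul_sub, mul_coe_of_const hx]
        noncomm_ring
      rw [hP, hL, add_mul]
      nth_rewrite 2 [h]
      simp only [horner, DiffOp.coe_add, DiffOp.coe_mul]
      noncomm_ring

lemma exists_hatP_eq (hx : D x = 0) {n : ℕ} (c : Fin n → F) : ∃ B : DiffOp D,
    (∀ i, 2 * n ≤ i → B.coeff i = 0) ∧ mapHom _ D ψ hψ (hatP n c) =
      coe D (hornerComb (fun k => ψ (v F k)) x fun j => ψ (MvPolynomial.C (c j))) * partial_ D
        - coe D (hornerComb (fun k => ψ (halfDerivV k)) x fun j => ψ (MvPolynomial.C (c j)))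
        + B * (mapHom _ D ψ hψ (formalL F) - coe D x) := by
  choose B hB h using exists_formalP_eq ψ hψ hx
  refine ⟨B n + ∑ l : Fin n, coe D (ψ (MvPolynomial.C (c l.rev))) * B l, fun i hi => ?_, ?_⟩
  · rw [DiffOp.coeff_add, hB n i hi, DiffOp.coeff_sum, Finset.sum_eq_zero, add_zero]
    intro l _
    rw [coeff_coe_mul, hB l i (by have := l.2; omega), mul_zero]
  · simp only [hatP, map_add, map_sum, map_mul, hornerComb, DiffOp.coe_add, DiffOp.coe_sum, DiffOp.coe_mul, add_mul,
      Finset.sum_mul]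
    rw [h n, Finset.sum_congr rfl fun l _ => by rw [h l]]
    simp only [mul_add, mul_sub, Finset.sum_add_distrib, Finset.sum_sub_distrib, mul_assoc,
      mapHom_apply, map_coe]
    abel

end Division

/-! ### The equation of the KdV hierarchy for the polynomials `∑ v_k λⁿ⁻ᵏ` -/

section StationaryEquation

variable {E : Type*} [CommRing E] (d : Der E) (U x : E)

/-- The operator `-∂³ + 4 (U - x) ∂ + 2 U'`. -/
def lenard : E →+ E where
  toFun a := -d (d (d a)) + 4 * (U - x) * d a + 2 * d U * a
  map_zero' := by simp
  map_add' a b := by simp only [map_add]; ring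

lemma lenard_apply (a : E) :
    lenard d U x a = -d (d (d a)) + 4 * (U - x) * d a + 2 * d U * a := rfl

variable {d U x}

lemma lenard_const_mul {a : E} (ha : d a = 0) (b : E) :
    lenard d U x (a * b) = a * lenard d U x b := by
  simp only [lenard_apply, Derivation.leibniz, ha, smul_eq_mul, mul_zero, add_zero]
  ring

/-- The sum telescopes: `-4 x w_{n+1}'` from the term `w_{n+1}` cancels `x` times the previous
value. -/
lemma lenard_horner (hx : d x = 0) {w : ℕ → E} (h0 : w 0 = 1)
    (hw : ∀ n, 4 * d (w (n + 1)) = -d (d (d (w n))) + 4 * U * d (w n) + 2 * d U * w n) (n : ℕ) :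
    lenard d U x (horner w x n) = 4 * d (w (n + 1)) := by
  induction n with
  | zero => rw [hw, lenard_apply, horner, h0, Derivation.map_one_eq_zero]; ring
  | succ n ih =>
    rw [horner, map_add, lenard_const_mul hx, ih, hw (n + 1), lenard_apply]
    ring

lemma lenard_hornerComb (hx : d x = 0) {w : ℕ → E} (h0 : w 0 = 1)
    (hw : ∀ n, 4 * d (w (n + 1)) = -d (d (d (w n))) + 4 * U * d (w n) + 2 * d U * w n) {n : ℕ}
    {c : Fin n → E} (hc : ∀ j, d (c j) = 0) :
    lenard d U x (hornerComb w x c) =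
      4 * (d (w (n + 1)) + ∑ l : Fin n, c l.rev * d (w (l + 1))) := by
  rw [hornerComb, map_add, map_sum, mul_add, Finset.mul_sum, lenard_horner hx h0 hw]
  congr 1
  refine Finset.sum_congr rfl fun l _ => ?_
  rw [lenard_const_mul (hc _), lenard_horner hx h0 hw]
  ring

lemma deriv_hornerComb (hx : d x = 0) {w w' : ℕ → E} (hw : ∀ n, d (w n) = 2 * w' n) {n : ℕ}
    {c : Fin n → E} (hc : ∀ j, d (c j) = 0) :
    d (hornerComb w x c) = 2 * hornerComb w' x c := by
  have h : ∀ k, d (horner w x k) = 2 * horner w' x k := by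
    intro k
    induction k with
    | zero => exact hw 0
    | succ k ih =>
      rw [horner, horner, map_add, Derivation.leibniz, hx, hw, ih, smul_eq_mul, smul_zero]
      ring
  rw [hornerComb, hornerComb, map_add, h, map_sum, mul_add, Finset.mul_sum]
  congr 1
  refine Finset.sum_congr rfl fun l _ => ?_
  rw [Derivation.leibniz, hc, h, smul_zero, add_zero, smul_eq_mul]
  ring

end StationaryEquation

/-! ### Degrees -/

section Degrees

variable {R : Type*} [CommRing R] [Nontrivial R]

lemma natDegree_horner_le (w : ℕ → R) (n : ℕ) :
    (horner (fun k => C (w k)) X n).natDegree ≤ n := by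
  induction n with
  | zero => simp [horner]
  | succ n ih =>
    rw [horner]
    refine (natDegree_add_le _ _).trans (max_le (by simp) ?_)
    exact natDegree_mul_le.trans (by rw [natDegree_X]; omega)

lemma degree_sum_horner_lt (w : ℕ → R) {n : ℕ} (c : Fin n → R) :
    (∑ l : Fin n, C (c l.rev) * horner (fun k => C (w k)) X l).degree < n := by
  refine mem_degreeLT.1 (Submodule.sum_mem _ fun l _ => mem_degreeLT.2 ?_)
  refine degree_le_natDegree.trans_lt ?_
  exact_mod_cast ((natDegree_C_mul_le _ _).trans (natDegree_horner_le w l)).trans_lt l.2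

lemma natDegree_hornerComb_le (w : ℕ → R) {n : ℕ} (c : Fin n → R) :
    (hornerComb (fun k => C (w k)) X (fun j => C (c j))).natDegree ≤ n := by
  rw [hornerComb]
  exact (natDegree_add_le _ _).trans (max_le (natDegree_horner_le w n)
    (natDegree_le_of_degree_le (degree_sum_horner_lt w c).le))

lemma monic_horner {w : ℕ → R} (h0 : w 0 = 1) (n : ℕ) :
    (horner (fun k => C (w k)) X n).Monic ∧
      (horner (fun k => C (w k)) X n).natDegree = n := by
  induction n with
  | zero => simp [horner, h0]
  | succ n ih =>
    have hm : (X * horner (fun k => C (w k)) X n).Monic := monic_X.mul ih.1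
    have hd : (X * horner (fun k => C (w k)) X n).natDegree = n + 1 := by
      rw [monic_X.natDegree_mul ih.1, natDegree_X, ih.2, add_comm]
    have hlt : (C (w (n + 1))).degree < (X * horner (fun k => C (w k)) X n).degree := by
      refine degree_C_le.trans_lt ?_
      rw [degree_eq_natDegree hm.ne_zero, hd]
      exact_mod_cast Nat.succ_pos n
    rw [horner]
    exact ⟨hm.add_of_right hlt, by rw [natDegree_add_eq_right_of_degree_lt hlt, hd]⟩

lemma monic_hornerComb {w : ℕ → R} (h0 : w 0 = 1) {n : ℕ} (c : Fin n → R) :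
    (hornerComb (fun k => C (w k)) X (fun j => C (c j))).Monic ∧
      (hornerComb (fun k => C (w k)) X (fun j => C (c j))).natDegree = n := by
  obtain ⟨hm, hd⟩ := monic_horner h0 n
  have hlt : (∑ l : Fin n, C (c l.rev) * horner (fun k => C (w k)) X l).degree <
      (horner (fun k => C (w k)) X n).degree := by
    rw [degree_eq_natDegree hm.ne_zero, hd]
    exact degree_sum_horner_lt w c
  rw [hornerComb]
  exact ⟨hm.add_of_left hlt, by rw [natDegree_add_eq_left_of_degree_lt hlt, hd]⟩

/-- `X² - R` is irreducible if the degree of `R` is odd. -/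
lemma irreducible_sq_sub_C {R : Type*} [CommRing R] [IsDomain R] {p : R[X]}
    (hp : Odd p.natDegree) : Irreducible (X ^ 2 - C p : R[X][X]) := by
  have hm : (X ^ 2 - C p : R[X][X]).Monic := monic_X_pow_sub_C p two_ne_zero
  have hd : (X ^ 2 - C p : R[X][X]).natDegree = 2 := natDegree_X_pow_sub_C
  rw [hm.irreducible_iff_roots_eq_zero_of_degree_le_three hd.ge (by omega)]
  -- A monic quadratic over a domain is reducible only if it has a root `r`; then `p = r²` would
  -- have even degree.
  refine Multiset.eq_zero_of_forall_notMem fun r hr => ?_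
  have h := (mem_roots hm.ne_zero).1 hr
  rw [IsRoot, eval_sub, eval_pow, eval_X, eval_C, sub_eq_zero] at h
  rw [← h, natDegree_pow] at hp
  exact absurd hp (by simp)

end Degrees

/-! ### Greatest common right divisor and factorization when the resultant vanishes -/

lemma DiffOp.map_map {E E' E'' : Type*} [CommRing E] [CommRing E'] [CommRing E''] {D : Der E}
    {D' : Der E'} {D'' : Der E''} (φ : E →+* E') (χ : E' →+* E'') (P : DiffOp D) :
    (P.map D' φ).map D'' χ = P.map D'' (χ.comp φ) :=
  Polynomial.map_map φ χ P.toPoly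

/-- If `a ∂ - b` with `a ≠ 0` is the remainder of `Q` modulo `P = -∂² + W` and the differential
resultant of `P` and `Q` vanishes, then the first subresultant is a greatest common right divisor
and yields a factorization of `P`. -/
lemma subres_one_isGCRD {G : Type*} [Field G] {δ : Der G} {P Q B : DiffOp δ} {a b W : G} {s : ℕ}
    (hs : 1 ≤ s) (hP : P = -partial_ δ ^ 2 + coe δ W) (hB : ∀ j, 2 * s ≤ j → B.coeff j = 0)
    (hQ : Q = coe δ a * partial_ δ - coe δ b + B * P) (hPo : P.order = 2)
    (hQo : Q.order = 2 * s + 1) (ha : a ≠ 0)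
    (hres : (δ a - b) * b + a * (a * W - δ b) = 0) :
    (subres 1 P Q).order = 1 ∧ IsGCRD (subres 1 P Q) P Q ∧
      P = (-partial_ δ - coe δ (-(subres 1 P Q).coeff 0 / (subres 1 P Q).coeff 1)) *
        (partial_ δ - coe δ (-(subres 1 P Q).coeff 0 / (subres 1 P Q).coeff 1)) ∧
      δ (-(subres 1 P Q).coeff 0 / (subres 1 P Q).coeff 1)
        + (-(subres 1 P Q).coeff 0 / (subres 1 P Q).coeff 1) ^ 2 = W := by
  rw [subres_one_of_remainder hs hP hB hQ hPo hQo]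
  have hφ : -(coe δ a * partial_ δ - coe δ b).coeff 0 /
      (coe δ a * partial_ δ - coe δ b).coeff 1 = b / a := by
    rw [coeff_coe_mul_partial_sub_coe, coeff_coe_mul_partial_sub_coe]
    simp
  rw [hφ]
  -- After division by `a²`, the vanishing resultant is the Riccati equation of `b / a`.
  have hric : δ (b / a) + (b / a) ^ 2 = W := by
    have h1 : b / a * a = b := div_mul_cancel₀ _ ha
    have h2 : δ b = b / a * δ a + a * δ (b / a) := by
      conv_lhs => rw [← h1, Derivation.leibniz, smul_eq_mul, smul_eq_mul]
    refine mul_left_cancel₀ (pow_ne_zero 2 ha) ?_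
    linear_combination (-a) * h2 - hres + (b / a * a + b - δ a) * h1
  have hfac : P = (-partial_ δ - coe δ (b / a)) * (partial_ δ - coe δ (b / a)) := by
    rw [hP]
    exact factorization_of_riccati hric
  have hlin : partial_ δ - coe δ (b / a) = coe δ a⁻¹ * (coe δ a * partial_ δ - coe δ b) := by
    rw [mul_sub, ← mul_assoc, ← DiffOp.coe_mul, ← DiffOp.coe_mul, inv_mul_cancel₀ ha,
      DiffOp.coe_one, one_mul, div_eq_inv_mul]
  have hdvd : DiffOp.RightDvd (coe δ a * partial_ δ - coe δ b) P :=
    ⟨(-partial_ δ - coe δ (b / a)) * coe δ a⁻¹, by rw [mul_assoc, ← hlin, ← hfac]⟩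
  refine ⟨?_, ⟨hdvd, ?_, ?_⟩, hfac, hric⟩
  · refine order_eq (fun i hi => ?_) ?_
    · rw [coeff_coe_mul_partial_sub_coe, if_neg (by omega), if_neg (by omega), sub_zero]
    · rw [coeff_coe_mul_partial_sub_coe]
      simpa using ha
  · obtain ⟨T, hT⟩ := hdvd
    exact ⟨1 + B * T, by rw [add_mul, one_mul, mul_assoc, ← hT, ← hQ]⟩
  · rintro H ⟨S, hS⟩ ⟨T, hT⟩
    exact ⟨T - B * S, by rw [sub_mul, mul_assoc, ← hS, ← hT, hQ, add_sub_cancel_right]⟩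

/-! ### The spectral curve and its function field -/

section SpectralCurve

variable {K : Type*} [Field K] (D : Der K) (u : K)

lemma subst_C (a : constants D) : subst D u (MvPolynomial.C a) = a :=
  MvPolynomial.aeval_C _ a

lemma subst_X (n : ℕ) : subst D u (MvPolynomial.X n) = D^[n] u :=
  MvPolynomial.aeval_X _ n

lemma subst_formalDeriv (p : DiffPoly (constants D)) :
    subst D u (formalDeriv (constants D) p) = D (subst D u p) := by
  induction p using MvPolynomial.induction_on with
  | C a => rw [formalDeriv_C, map_zero, subst_C]; exact a.2.symm
  | add p q hp hq => simp only [map_add, hp, hq]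
  | mul_X p n hp =>
    simp only [Derivation.leibniz, formalDeriv_X, smul_eq_mul, map_add, map_mul, hp, subst_X,
      Function.iterate_succ_apply']

lemma coeffDeriv_X {E : Type*} [CommRing E] (d : Der E) : coeffDeriv d (X : E[X]) = 0 :=
  letI : Differential E := ⟨d⟩
  Differential.mapCoeffs_X

lemma natDegree_coeffDeriv_le {E : Type*} [CommRing E] (d : Der E) (p : E[X]) :
    (coeffDeriv d p).natDegree ≤ p.natDegree :=
  natDegree_le_iff_coeff_eq_zero.2 fun i hi => by
    rw [coeff_coeffDeriv, coeff_eq_zero_of_natDegree_lt hi, map_zero]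

/-- The substitution `C{u} → K → K[λ, μ]`. -/
def substBi : DiffPoly (constants D) →+* K[X][X] := (C.comp C).comp (subst D u)

lemma substBi_formalDeriv (p : DiffPoly (constants D)) :
    substBi D u (formalDeriv (constants D) p) = biDeriv D (substBi D u p) := by
  simp only [substBi, RingHom.comp_apply, subst_formalDeriv, biDeriv, coeffDeriv_C]

variable {s : ℕ} (c : Fin s → constants D)

/-- The leading coefficient in `K[λ]` of the remainder of `A_{2s+1}` modulo `L - λ`. -/
def remA : K[X] :=
  hornerComb (fun k => C (subst D u (v (constants D) k))) X fun j => C (c j : K)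

/-- Half the derivative of `remA`. -/
def remB : K[X] :=
  hornerComb (fun k => C (subst D u (halfDerivV k))) X fun j => C (c j : K)

/-- The polynomial `R` with `f_s = R(λ) - μ²`. -/
def curvePoly : K[X] :=
  remB D u c ^ 2 - remA D u c * coeffDeriv D (remB D u c) + remA D u c ^ 2 * (C u - X)

lemma opLLambda_eq_map : opLLambda D u =
    mapHom _ (biDeriv D) (substBi D u) (substBi_formalDeriv D u) (formalL (constants D))
      - coe (biDeriv D) (C X) := by
  have h : schrodinger D u =
      mapHom _ D (subst D u) (subst_formalDeriv D u) (formalL (constants D)) := by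
    rw [formalL, map_add, map_neg, map_pow]
    simp only [mapHom_apply, map_partial, map_coe, subst_X]
    rfl
  rw [opLLambda, h, mapHom_apply, DiffOp.map_map]
  rfl

lemma opAMu_eq_map : opAMu D u c =
    mapHom _ (biDeriv D) (substBi D u) (substBi_formalDeriv D u) (hatP s c)
      - coe (biDeriv D) X := by
  rw [opAMu, opA, DiffOp.map_map]
  rfl

lemma opLLambda_eq : opLLambda D u =
    -partial_ (biDeriv D) ^ 2 + coe (biDeriv D) (C (C u - X)) := by
  rw [opLLambda_eq_map, formalL, map_add, map_neg, map_pow]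
  simp only [mapHom_apply, map_partial, map_coe, substBi, RingHom.comp_apply, subst_X]
  rw [add_sub_assoc, ← DiffOp.coe_sub, C_sub]
  rfl

lemma opAMu_coeff (hs : 1 ≤ s) : (∀ i, 2 * s + 1 < i → (opAMu D u c).coeff i = 0) ∧
    (opAMu D u c).coeff (2 * s + 1) = (-1) ^ s := by
  rw [opAMu_eq_map]
  refine ⟨fun i hi => ?_, ?_⟩
  · rw [DiffOp.coeff_sub, mapHom_apply, DiffOp.coeff_map, (hatP_coeff c).1 i hi, DiffOp.coeff_coe,
      if_neg (by omega), map_zero, sub_zero]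
  · rw [DiffOp.coeff_sub, mapHom_apply, DiffOp.coeff_map, (hatP_coeff c).2, DiffOp.coeff_coe,
      if_neg (by omega), sub_zero, map_pow, map_neg, map_one]

/-- Division with `x = λ`. The term `-μ` has order zero, so it only changes the remainder. -/
lemma exists_opAMu_eq : ∃ B : DiffOp (biDeriv D), (∀ i, 2 * s ≤ i → B.coeff i = 0) ∧
    opAMu D u c = coe (biDeriv D) (C (remA D u c)) * partial_ (biDeriv D)
      - coe (biDeriv D) (C (remB D u c) + X) + B * opLLambda D u := by
  have hx : biDeriv D (C X) = 0 := by rw [biDeriv, coeffDeriv_C, coeffDeriv_X, C_0]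
  obtain ⟨B, hB, h⟩ := exists_hatP_eq (substBi D u) (substBi_formalDeriv D u) hx c
  have hc : ∀ j, substBi D u (MvPolynomial.C (c j)) = C (C (c j : K)) := fun j => by
    rw [substBi, RingHom.comp_apply, subst_C]; rfl
  refine ⟨B, hB, ?_⟩
  rw [opAMu_eq_map, h, opLLambda_eq_map, remA, remB, map_hornerComb, map_hornerComb,
    DiffOp.coe_add]
  simp only [hc]
  simp only [substBi, RingHom.comp_apply]
  abel

lemma opLLambda_order : (opLLambda D u).order = 2 := by
  have h := coeff_neg_partial_sq_add_coe (opLLambda_eq D u)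
  exact order_eq h.1 (by rw [h.2]; simp)

lemma opAMu_order (hs : 1 ≤ s) : (opAMu D u c).order = 2 * s + 1 :=
  order_eq (opAMu_coeff D u c hs).1 (by rw [(opAMu_coeff D u c hs).2]; simp)

/-- The equation of the spectral curve in terms of the remainder of `A_{2s+1}` modulo `L - λ`. -/
lemma spectralPoly_eq_remainder (hs : 1 ≤ s) : spectralPoly D u c =
    (biDeriv D (C (remA D u c)) - (C (remB D u c) + X)) * (C (remB D u c) + X)
      + C (remA D u c) * (C (remA D u c) * C (C u - X) - biDeriv D (C (remB D u c) + X)) := by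
  obtain ⟨B, hB, h⟩ := exists_opAMu_eq D u c
  rw [spectralPoly, dRes_of_remainder (opLLambda_eq D u) hB h (opLLambda_order D u)
    (opAMu_order D u c hs)]

lemma toFunField_self (f : K[X][X]) : toFunField f f = 0 := by
  rw [toFunField, RingHom.comp_apply, AdjoinRoot.mk_self, map_zero]

lemma monic_remA : (remA D u c).Monic ∧ (remA D u c).natDegree = s :=
  monic_hornerComb (w := fun k => subst D u (v (constants D) k)) (by simp [v])
    (fun j => (c j : K))

/-- The summand `a² (u - λ)` has degree `2s + 1`; the others have degree at most `2s`. -/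
lemma natDegree_curvePoly : (curvePoly D u c).natDegree = 2 * s + 1 := by
  obtain ⟨hm, hd⟩ := monic_remA D u c
  have hB : (remB D u c).natDegree ≤ s := natDegree_hornerComb_le _ _
  have hB' := (natDegree_coeffDeriv_le D (remB D u c)).trans hB
  have hX : (C u - X : K[X]).natDegree = 1 := by
    rw [← neg_sub, natDegree_neg, natDegree_X_sub_C]
  have h1 : (remA D u c ^ 2 * (C u - X)).natDegree = 2 * s + 1 := by
    rw [(hm.pow 2).natDegree_mul' (by
      intro h; rw [h] at hX; simp at hX), hm.natDegree_pow, hX, hd]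
  have h2 : (remB D u c ^ 2 - remA D u c * coeffDeriv D (remB D u c)).natDegree ≤ 2 * s := by
    refine (natDegree_sub_le _ _).trans (max_le ?_ ?_)
    · exact natDegree_pow_le.trans (by omega)
    · refine natDegree_mul_le.trans ?_
      omega
  rw [curvePoly, natDegree_add_eq_right_of_natDegree_lt (by omega), h1]

variable [CharZero K]

instance : CharZero (constants D) :=
  ⟨fun a b h => Nat.cast_injective (R := K) (by simpa using congrArg (Subtype.val) h)⟩

lemma coeffDeriv_remA : coeffDeriv D (remA D u c) = 2 * remB D u c := by
  refine deriv_hornerComb (coeffDeriv_X D) (fun n => ?_) fun j => ?_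
  · rw [coeffDeriv_C, ← subst_formalDeriv, ← C_mul_two _ (formalDeriv _ (v _ n)), map_mul, C_mul,
      map_ofNat, map_ofNat]
    rfl
  · rw [coeffDeriv_C, show D (c j : K) = 0 from (c j).2, C_0]

/-- Since `a' = 2 remB`, the product `(a' - b) b` is `(remB - μ) (remB + μ)`, so no term linear in
`μ` survives. -/
lemma spectralPoly_eq (hs : 1 ≤ s) :
    spectralPoly D u c = -(X ^ 2 - C (curvePoly D u c)) := by
  rw [spectralPoly_eq_remainder D u c hs]
  simp only [curvePoly, map_add, coeffDeriv_C, coeffDeriv_X, coeffDeriv_remA, C_mul, C_sub, C_pow,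
    map_ofNat]
  ring

lemma irreducible_spectralPoly (hs : 1 ≤ s) : Irreducible (spectralPoly D u c) := by
  rw [spectralPoly_eq D u c hs]
  exact (Associated.refl _).neg_right.irreducible
    (irreducible_sq_sub_C (p := curvePoly D u c) (by rw [natDegree_curvePoly]; simp))

/-- The telescoped value is a multiple of `KdV_s(u, c)`, by `kdv_eq`. This is where the KdV equation
enters. -/
lemma lenard_remA (hc : c ∈ kdvConstants D u s) :
    lenard (coeffDeriv D) (C u) X (remA D u c) = 0 := by
  rw [remA, lenard_hornerComb (coeffDeriv_X D) (by simp [v]) (fun n => ?_)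
    (fun j => by rw [coeffDeriv_C, show D (c j : K) = 0 from (c j).2, C_0])]
  · have h : 2 * (D (subst D u (v _ (s + 1)))
        + ∑ l : Fin s, (c l.rev : K) * D (subst D u (v _ (l + 1)))) = 0 := by
      have hc' : subst D u (bigKdV s c) = 0 := hc
      simp only [bigKdV, map_add, map_sum, map_mul, kdv_eq, subst_C, subst_formalDeriv,
        map_ofNat] at hc'
      rw [mul_add, Finset.mul_sum]
      refine Eq.trans (congrArg (_ + ·) (Finset.sum_congr rfl fun l _ => ?_)) hc'
      ring
    have h' := (mul_eq_zero.1 h).resolve_left two_ne_zero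
    simp only [coeffDeriv_C, ← C_mul, ← map_sum, ← C_add]
    rw [h', C_0, mul_zero]
  · have h := congrArg (fun p => C (subst D u p)) (four_mul_formalDeriv_v_succ (constants D) n)
    simp only [map_mul, map_add, map_neg, subst_formalDeriv, map_ofNat, subst_X, Function.iterate_zero,
      id_eq, Function.iterate_one] at h
    simpa only [coeffDeriv_C] using h

/-- `R` is a first integral of the third-order equation for `a`: twice its derivative is `a` times
the left-hand side. -/
lemma coeffDeriv_curvePoly (hc : c ∈ kdvConstants D u s) :
    coeffDeriv D (curvePoly D u c) = 0 := by
  have h := lenard_remA D u c hc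
  have h2 : coeffDeriv D 2 = 0 := by simpa using (coeffDeriv D).map_natCast 2
  rw [lenard_apply] at h
  simp only [coeffDeriv_remA, Derivation.leibniz, h2, smul_eq_mul, mul_zero, add_zero] at h
  refine mul_left_cancel₀ (two_ne_zero (α := K[X])) ?_
  simp only [curvePoly, map_add, map_sub, Derivation.leibniz, Derivation.leibniz_pow,
    coeffDeriv_remA, coeffDeriv_X, smul_eq_mul]
  linear_combination remA D u c * h

lemma biDeriv_spectralPoly (hs : 1 ≤ s) (hc : c ∈ kdvConstants D u s) :
    biDeriv D (spectralPoly D u c) = 0 := by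
  rw [spectralPoly_eq D u c hs, map_neg, map_sub, Derivation.leibniz_pow, biDeriv, coeffDeriv_X,
    coeffDeriv_C, coeffDeriv_curvePoly D u c hc]
  simp

/-- A nonzero polynomial in `λ` alone is no multiple of `f_s`, which has degree 2 in `μ`. -/
lemma toFunField_remA_ne_zero (hs : 1 ≤ s) :
    toFunField (spectralPoly D u c) (C (remA D u c)) ≠ 0 := by
  have hirr := irreducible_spectralPoly D u c hs
  have := coordRing_isDomain hirr
  have hA : remA D u c ≠ 0 := (monic_remA D u c).1.ne_zero
  rw [toFunField, RingHom.comp_apply, Ne, FaithfulSMul.algebraMap_eq_zero_iff, AdjoinRoot.mk_eq_zero,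
    spectralPoly_eq D u c hs, neg_dvd]
  intro h
  have h' := natDegree_le_of_dvd h (C_ne_zero.2 hA)
  rw [natDegree_X_pow_sub_C, natDegree_C] at h'
  omega

end SpectralCurve

end KdV

end

theorem mainTheorem3 {K : Type*} [Field K] [CharZero K] (D : KdV.Der K)
    [IsAlgClosed (KdV.constants D)] (u : K) (s : ℕ) (hs : KdV.IsKdVLevel D u s)
    (c : Fin s → KdV.constants D) (hc : c ∈ KdV.kdvConstants D u s) :
    ∃ (hconst : KdV.biDeriv D (KdV.spectralPoly D u c) = 0)
      (hirr : Irreducible (KdV.spectralPoly D u c)),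
      haveI := KdV.coordRing_isDomain hirr
      let Γ := KdV.FunField (KdV.spectralPoly D u c)
      let ι : Polynomial (Polynomial K) →+* Γ := KdV.toFunField (KdV.spectralPoly D u c)
      let δ : KdV.Der Γ := KdV.funDeriv D (KdV.spectralPoly D u c) hconst
      let P : KdV.DiffOp δ := (KdV.opLLambda D u).map δ ι
      let Q : KdV.DiffOp δ := (KdV.opAMu D u c).map δ ι
      let L₁ : KdV.DiffOp δ := KdV.DiffOp.subres 1 P Q
      let φ : Γ := -L₁.coeff 0 / L₁.coeff 1
      L₁.order = 1 ∧ KdV.DiffOp.IsGCRD L₁ P Q ∧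
        P = (-KdV.DiffOp.partial_ δ - KdV.DiffOp.coe δ φ) *
              (KdV.DiffOp.partial_ δ - KdV.DiffOp.coe δ φ) ∧
        δ φ + φ ^ 2 = ι (Polynomial.C (Polynomial.C u)) - ι (Polynomial.C Polynomial.X) := by
  have hs1 : 1 ≤ s := hs.1.1
  have hconst := KdV.biDeriv_spectralPoly D u c hs1 hc
  have hirr := KdV.irreducible_spectralPoly D u c hs1
  refine ⟨hconst, hirr, ?_⟩
  have := KdV.coordRing_isDomain hirr
  intro Γ ι δ P Q L₁ φ
  have hι : ∀ p, ι (KdV.biDeriv D p) = δ (ι p) := fun p =>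
    (KdV.funDeriv_toFunField D _ hconst p).symm
  have hP : P = -KdV.DiffOp.partial_ δ ^ 2
      + KdV.DiffOp.coe δ (ι (Polynomial.C (Polynomial.C u - Polynomial.X))) := by
    change KdV.DiffOp.mapHom _ δ ι hι _ = _
    rw [KdV.opLLambda_eq, map_add, map_neg, map_pow]
    simp only [KdV.DiffOp.mapHom_apply, KdV.DiffOp.map_partial, KdV.DiffOp.map_coe]
  obtain ⟨B₀, hB₀, hA₀⟩ := KdV.exists_opAMu_eq D u c
  obtain ⟨B, hB, hQ⟩ : ∃ B : KdV.DiffOp δ, (∀ i, 2 * s ≤ i → B.coeff i = 0) ∧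
      Q = KdV.DiffOp.coe δ (ι (Polynomial.C (KdV.remA D u c))) * KdV.DiffOp.partial_ δ
        - KdV.DiffOp.coe δ (ι (Polynomial.C (KdV.remB D u c) + Polynomial.X)) + B * P := by
    refine ⟨B₀.map δ ι, fun i hi => ?_, ?_⟩
    · rw [KdV.DiffOp.coeff_map, hB₀ i hi, map_zero]
    · change KdV.DiffOp.mapHom _ δ ι hι _ = _
      rw [hA₀, map_add, map_sub, map_mul, map_mul]
      simp only [KdV.DiffOp.mapHom_apply, KdV.DiffOp.map_partial, KdV.DiffOp.map_coe]
      rfl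
  -- Since `f_s` is zero in `K(Γ)`, its expression through `a` and `b` becomes the vanishing of the
  -- resultant there.
  have hres := congrArg ι (KdV.spectralPoly_eq_remainder D u c hs1)
  rw [KdV.toFunField_self, map_add, map_mul, map_mul, map_sub, map_sub, map_mul, hι, hι] at hres
  have hPo : P.order = 2 := by
    have h := KdV.DiffOp.coeff_neg_partial_sq_add_coe hP
    exact KdV.DiffOp.order_eq h.1 (by rw [h.2]; simp)
  have hQo : Q.order = 2 * s + 1 := by
    have h := KdV.opAMu_coeff D u c hs1
    refine KdV.DiffOp.order_eq (fun i hi => ?_) ?_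
    · rw [KdV.DiffOp.coeff_map, h.1 i hi, map_zero]
    · rw [KdV.DiffOp.coeff_map, h.2]
      simp
  obtain ⟨h1, h2, h3, h4⟩ := KdV.subres_one_isGCRD hs1 hP hB hQ hPo hQo
    (KdV.toFunField_remA_ne_zero D u c hs1) hres.symm
  exact ⟨h1, h2, h3, h4.trans (by rw [← map_sub, ← Polynomial.C_sub])⟩
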